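/- Let $G$ be a (finite-dimensional real) Lie group acting properly on a space $X$, i.e. the map $G\times X\to X\times X$, $(g,x)\mapsto(gx,x)$, is proper. Suppose that $X$ is a completely regular Hausdorff space, or that $X$ is a $G$-CW complex (a union of closed subspaces $\emptyset=X_{-1}\subseteq X_0\subseteq X_1\subseteq\cdots$ with the colimit topology, where each $X_n$ is obtained from $X_{n-1}$ as a $G$-space by attaching equivariant cells $G/H_i\times D^n$ along $G/H_i\times S^{n-1}$, with $H_i$ closed subgroups of $G$). Let $H$ be a compact subgroup of $G$ (not necessarily normal) with normalizer $NH$, and let $X^H$ be the subspace of points of $X$ fixed by $H$. If the action of $G$ on $X$ has only one orbit type $G/H$, i.e. every isotropy group $G_x$, $x\in X$, is conjugate to $H$ in $G$, then the map $$\Phi\colon G\times_{NH}X^H\to X,\qquad [g,x]\mapsto gx,$$ is a $G$-homeomorphism, i.e. a $G$-equivariant homeomorphism. Here $G\times_{NH}X^H$ is the quotient space of $G\times X^H$ by the action $n\cdot(g,x)=(gn^{-1},nx)$ of $NH$, and $G$ acts on it by $g\cdot[g',x]=[gg',x]$. -/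

import Mathlib

open scoped Manifold ContDiff

universe u v

namespace OneOrbitType

/-! ### Balanced products -/

section Balanced

variable {G : Type u} [Group G]

/-- The equivalence relation on `G × Y` whose classes are the orbits of the action
`k • (g, y) = (g * k⁻¹, k • y)` of the subgroup `K` of `G`, where `Y` is a `K`-set. -/
def balancedSetoid (K : Subgroup G) (Y : Type v) [MulAction K Y] : Setoid (G × Y) where
  r p q := ∃ k : K, q = (p.1 * (k : G)⁻¹, k • p.2)
  iseqv :=
    { refl := fun p => ⟨1, by simp⟩
      symm := by
        rintro p _ ⟨k, rfl⟩
        exact ⟨k⁻¹, by simp⟩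
      trans := by
        rintro p _ _ ⟨k, rfl⟩ ⟨l, rfl⟩
        exact ⟨l * k, by simp [mul_assoc, mul_smul]⟩ }

/-- The balanced product `G ×_K Y`. If `Y` is a `K`-space, it carries the quotient topology
of the product topology on `G × Y`. -/
def BalancedProduct (K : Subgroup G) (Y : Type v) [MulAction K Y] : Type (max u v) :=
  Quotient (balancedSetoid K Y)

/-- The class `[g, y]` in `G ×_K Y`. -/
def BalancedProduct.mk (K : Subgroup G) {Y : Type v} [MulAction K Y] (g : G) (y : Y) :
    BalancedProduct K Y :=
  Quotient.mk (balancedSetoid K Y) (g, y)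

instance [TopologicalSpace G] (K : Subgroup G) (Y : Type v) [MulAction K Y]
    [TopologicalSpace Y] : TopologicalSpace (BalancedProduct K Y) :=
  inferInstanceAs (TopologicalSpace (Quotient (balancedSetoid K Y)))

/-- `G` acts on `G ×_K Y` by `g • [g', y] = [g * g', y]`. -/
instance (K : Subgroup G) (Y : Type v) [MulAction K Y] : MulAction G (BalancedProduct K Y) where
  smul g := Quotient.map (fun p => (g * p.1, p.2)) (by
    rintro p _ ⟨k, rfl⟩
    exact ⟨k, by simp [mul_assoc]⟩)
  one_smul := by
    rintro ⟨p⟩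
    exact congrArg (Quotient.mk _) (by simp)
  mul_smul g h := by
    rintro ⟨p⟩
    exact congrArg (Quotient.mk _) (by simp [mul_assoc])

end Balanced

/-! ### The map `Φ : G ×_{NH} X^H → X` -/

section Phi

variable {G : Type u} [Group G] {X : Type v} [MulAction G X]

/-- The normalizer `NH` acts on the fixed point set `X^H` by restriction of the action of `G`. -/
instance normalizerAction (H : Subgroup G) :
    MulAction (Subgroup.normalizer (H : Set G)) (MulAction.fixedPoints H X) where
  smul n x := ⟨(n : G) • (x : X), by
    intro h
    have hn : (n : G)⁻¹ * h * n ∈ H :=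
      (Subgroup.mem_normalizer_iff''.mp n.2 h).mp h.2
    have hx : ((n : G)⁻¹ * h * n) • (x : X) = x := x.2 ⟨_, hn⟩
    change (h : G) • (n : G) • (x : X) = (n : G) • (x : X)
    conv_rhs => rw [← hx]
    simp [smul_smul, mul_assoc]⟩
  one_smul x := Subtype.ext (one_smul G (x : X))
  mul_smul m n x := Subtype.ext (mul_smul (m : G) (n : G) (x : X))

/-- The map `Φ : G ×_{NH} X^H → X`, `[g, x] ↦ g • x`. -/
def Phi (H : Subgroup G) (X : Type v) [MulAction G X] :
    BalancedProduct (Subgroup.normalizer (H : Set G)) (MulAction.fixedPoints H X) → X :=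
  Quotient.lift (fun p => p.1 • (p.2 : X)) (by
    rintro p _ ⟨k, rfl⟩
    change p.1 • (p.2 : X) = (p.1 * (k : G)⁻¹) • (k : G) • (p.2 : X)
    simp [smul_smul])

/-- The action of `G` on `X` has only one orbit type `G/H`: all isotropy groups are conjugate
to `H`. -/
def HasOneOrbitType (H : Subgroup G) (X : Type v) [MulAction G X] : Prop :=
  ∀ x : X, ∃ g : G, MulAction.stabilizer G x = H.map (MulAut.conj g).toMonoidHom

end Phi

/-! ### `G`-CW complexes -/

/-- The closed unit disk `D^n`. -/
abbrev Disk (n : ℕ) : Type := Metric.closedBall (0 : EuclideanSpace ℝ (Fin n)) 1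

/-- A structure of `G`-CW complex on the `G`-space `X`: a filtration
`∅ = X_{-1} ⊆ X_0 ⊆ X_1 ⊆ …` of `X` by closed subspaces with union `X`, such that `X` has the
colimit topology and, for every `n`, `X_n` is the pushout of
`X_{n-1} ← ∐ᵢ G/Hᵢ × S^{n-1} → ∐ᵢ G/Hᵢ × D^n` in the category of `G`-spaces, where the `Hᵢ` are
closed subgroups of `G`. The index is shifted: `skel n` is `X_{n-1}`. The pushout property is
spelled out as its underlying statement on sets (`bijOn_char`) and its statement on
topologies (`isClosed_of_succ`). -/
structure GCWComplex (G : Type u) [Group G] [TopologicalSpace G]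
    (X : Type v) [TopologicalSpace X] [MulAction G X] where
  /-- `skel n` is the skeleton `X_{n-1}`. -/
  skel : ℕ → Set X
  /-- The index set of the equivariant `n`-cells. -/
  Cell : ℕ → Type v
  /-- The subgroup `Hᵢ` of the equivariant `n`-cell `G/Hᵢ × D^n`. -/
  stab : ∀ n, Cell n → Subgroup G
  /-- The characteristic map of an equivariant `n`-cell. -/
  char : ∀ (n : ℕ) (i : Cell n), (G ⧸ stab n i) × Disk n → X
  isClosed_stab : ∀ n i, IsClosed (stab n i : Set G)
  continuous_char : ∀ n i, Continuous (char n i)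
  char_smul : ∀ n i (g : G) (c : G ⧸ stab n i) (d : Disk n),
    char n i (g • c, d) = g • char n i (c, d)
  skel_zero : skel 0 = ∅
  skel_subset_succ : ∀ n, skel n ⊆ skel (n + 1)
  iUnion_skel : ⋃ n, skel n = Set.univ
  isClosed_skel : ∀ n, IsClosed (skel n)
  /-- The boundary of an `n`-cell is mapped into `X_{n-1}`. -/
  char_mem_skel : ∀ n i (c : G ⧸ stab n i) (d : Disk n),
    ‖(d : EuclideanSpace ℝ (Fin n))‖ = 1 → char n i (c, d) ∈ skel n
  /-- The disjoint union of the open `n`-cells is mapped bijectively onto `X_n ∖ X_{n-1}`. -/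
  bijOn_char : ∀ n, Set.BijOn
    (fun p : (i : Cell n) × ((G ⧸ stab n i) × Disk n) => char n p.1 p.2)
    {p | ‖(p.2.2 : EuclideanSpace ℝ (Fin n))‖ < 1} (skel (n + 1) \ skel n)
  /-- `X_n` has the quotient topology of `X_{n-1} ⊔ ∐ᵢ G/Hᵢ × D^n`. -/
  isClosed_of_succ : ∀ n (A : Set X), A ⊆ skel (n + 1) → IsClosed (A ∩ skel n) →
    (∀ i, IsClosed (char n i ⁻¹' A)) → IsClosed A
  /-- `X` has the colimit topology of its skeleta. -/
  isClosed_of_skel : ∀ A : Set X, (∀ n, IsClosed (A ∩ skel n)) → IsClosed A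

end OneOrbitType

/-!
`Φ` is continuous, equivariant and surjective for formal reasons. Injectivity and openness rest on
two facts about a compact subgroup `H` of a Lie group `G`.

* `H` is not conjugate to a proper subgroup of itself (`conj_inv_mem_of_forall_conj_mem`). Hence
  every point of `X^H` has isotropy group exactly `H`, which gives injectivity (`injective_phi`).
* Neighboring subgroups, after Montgomery and Zippin: a compact subgroup contained in a small
  neighborhood of `H` is conjugate into `H` by an element close to `1`
  (`exists_nhdsSet_forall_conj_mem_of_lieGroup`).

Openness: let `y` be in `X^H` and `x` close to `y`. By properness the isotropy group `G_x` lies in a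
small neighborhood of `G_y = H` (`ProperSMul.eventually_stabilizer_subset`), so `u⁻¹ G_x u ⊆ H` for
some `u` close to `1`. Since `G_x` is conjugate to `H`, the first fact gives `u⁻¹ G_x u = H`, so
`x = Φ [u, u⁻¹ x]` with `(u, u⁻¹ x)` close to `(1, y)` in `G × X^H`.

Both facts come from a description of `H ⊆ G` near `1` that avoids the exponential map and the
closed subgroup theorem. It uses *coset functions*: `C²` functions on `G` invariant under right
translation by `H`. Averages of bump functions over `H` are coset functions, so these separate the
points of `G/H` (`exists_isCosetFunction_ne_one`). Let `𝔥` be the space of directions at `1` along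
which all coset functions have vanishing derivative. Finitely many coset functions form a map `Θ` whose
differential at `1` has kernel `𝔥`; by left invariance `Θ` has constant rank near `1`, so all coset
functions are constant along the fibres of `Θ` (`StraightCoords.eventually_eq_inv_proj`). Therefore
`H` is near `1` a submanifold tangent to `𝔥`, and a complement of `𝔥` parametrizes a transversal.

For the first fact, conjugation of `H` into itself has a bijective differential on `𝔥`, so its image
is open in `H`; as `H` is locally connected and compact, comparing identity components and their
indices shows that the image is `H`.

For the second fact, take a vector-valued coset function `Ψ` vanishing on `H` whose differentials
are injective in transverse directions along `H`. Then `‖Ψ‖` is strictly midpoint-convex in these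
directions, and so is `g ↦ max_{k ∈ K} ‖Ψ (k * g)‖` for a compact subgroup `K` close to `H`. The
minimum of the latter near `H` is attained on a single coset `gH`, which `K` must fix, so
`g⁻¹ K g ⊆ H` (`Subgroup.exists_nhdsSet_forall_conj_mem`).
-/

open Set Filter Topology MeasureTheory

/-! ### Averages of smooth functions over a compact set of parameters -/

section ParametricIntegral

theorem continuousOn_integral_of_compactSpace {X F P : Type*} [TopologicalSpace X]
    [NormedAddCommGroup F] [NormedSpace ℝ F] [TopologicalSpace P] [CompactSpace P]
    [MeasurableSpace P] [BorelSpace P] (μ : Measure P) [IsFiniteMeasure μ] {U : Set X}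
    {f : X → P → F}
    (hf : ContinuousOn (Function.uncurry f) (U ×ˢ univ)) :
    ContinuousOn (fun a => ∫ p, f a p ∂μ) U := by
  have h := continuousOn_integral_bilinear_of_locally_integrable_of_compact_support
    (μ := μ) (ContinuousLinearMap.lsmul ℝ ℝ : ℝ →L[ℝ] F →L[ℝ] F) (k := univ) (g := fun _ => (1 : ℝ))
    isCompact_univ hf (fun _ _ _ h => absurd (mem_univ _) h) (integrable_const _).integrableOn
  simpa using h

variable {E : Type*} [NormedAddCommGroup E] [NormedSpace ℝ E]
  {F : Type*} [NormedAddCommGroup F] [NormedSpace ℝ F]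
  {P : Type*} [TopologicalSpace P] [CompactSpace P] [MeasurableSpace P] [BorelSpace P]
  (μ : Measure P) [IsFiniteMeasure μ] {U : Set E}

theorem hasFDerivAt_integral_of_compactSpace [FiniteDimensional ℝ E] (hU : IsOpen U) {f : E → P → F}
    {f' : E → P → E →L[ℝ] F} (hf : ContinuousOn (Function.uncurry f) (U ×ˢ univ))
    (hf' : ContinuousOn (Function.uncurry f') (U ×ˢ univ))
    (hd : ∀ a ∈ U, ∀ p, HasFDerivAt (f · p) (f' a p) a) {a : E} (ha : a ∈ U) :
    HasFDerivAt (fun a => ∫ p, f a p ∂μ) (∫ p, f' a p ∂μ) a := by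
  have hc : ∀ b ∈ U, Continuous (f b) := fun b hb =>
    hf.comp_continuous (by fun_prop : Continuous fun p : P => (b, p)) fun p => ⟨hb, mem_univ _⟩
  have hc' : ∀ b ∈ U, Continuous (f' b) := fun b hb =>
    hf'.comp_continuous (by fun_prop : Continuous fun p : P => (b, p)) fun p => ⟨hb, mem_univ _⟩
  obtain ⟨r, hr, hrU⟩ := Metric.nhds_basis_closedBall.mem_iff.mp (hU.mem_nhds ha)
  obtain ⟨C, hC⟩ := ((isCompact_closedBall a r).prod
    (isCompact_univ (X := P))).exists_bound_of_continuousOn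
    (hf'.mono (prod_mono_left hrU))
  refine hasFDerivAt_integral_of_dominated_of_fderiv_le (bound := fun _ => C)
    (Metric.closedBall_mem_nhds a hr) ?_ ?_ ?_ ?_ (integrable_const _) ?_
  · filter_upwards [hU.mem_nhds ha] with b hb
    exact ((hc b hb).stronglyMeasurable_of_hasCompactSupport
      (HasCompactSupport.of_compactSpace _)).aestronglyMeasurable
  · exact (hc a ha).integrable_of_hasCompactSupport (HasCompactSupport.of_compactSpace _)
  · exact ((hc' a ha).stronglyMeasurable_of_hasCompactSupport
      (HasCompactSupport.of_compactSpace _)).aestronglyMeasurable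
  · exact Eventually.of_forall fun p b hb => hC (b, p) ⟨hb, mem_univ _⟩
  · exact Eventually.of_forall fun p b hb => hd b (hrU hb) p

variable {M : Type*} [TopologicalSpace M] {E' : Type*} [NormedAddCommGroup E'] [NormedSpace ℝ E']
  {I : ModelWithCorners ℝ E' M} {N : Type*} [TopologicalSpace N] [ChartedSpace M N]

/-- The partial derivative in the linear variable of a function of class `C^(m+1)` on
`U × N` is of class `C^m`. -/
theorem contMDiffOn_fderiv_left [IsManifold I 1 N] (hU : IsOpen U) {m : ℕ} {f : E → N → F}
    (hf : ContMDiffOn (𝓘(ℝ, E).prod I) 𝓘(ℝ, F) (m + 1 : ℕ) (Function.uncurry f) (U ×ˢ univ)) :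
    ContMDiffOn (𝓘(ℝ, E).prod I) 𝓘(ℝ, E →L[ℝ] F) m
      (Function.uncurry fun a p => fderiv ℝ (f · p) a) (U ×ˢ univ) := by
  rintro ⟨a, p⟩ ⟨ha, -⟩
  have hat : ContMDiffAt (𝓘(ℝ, E).prod I) 𝓘(ℝ, F) (m + 1 : ℕ) (Function.uncurry f) (a, p) :=
    hf.contMDiffAt ((hU.prod isOpen_univ).mem_nhds ⟨ha, mem_univ _⟩)
  have h := ContMDiffAt.mfderiv (I := 𝓘(ℝ, E)) (I' := 𝓘(ℝ, F)) (J := 𝓘(ℝ, E).prod I)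
    (m := m) (n := (m + 1 : ℕ)) (x₀ := (a, p)) (fun q : E × N => fun b : E => f b q.2)
    (fun q => q.1)
    (hat.comp (x := ((a, p), a)) (f := fun q : (E × N) × E => (q.2, q.1.2))
      (contMDiffAt_snd.prodMk (contMDiffAt_snd.comp _ contMDiffAt_fst)))
    contMDiffAt_fst (by norm_cast)
  erw [inTangentCoordinates_model_space] at h
  simp only [mfderiv_eq_fderiv] at h
  exact h.contMDiffWithinAt

theorem hasFDerivAt_fderiv_left (hU : IsOpen U) {m : ℕ} {f : E → N → F}
    (hf : ContMDiffOn (𝓘(ℝ, E).prod I) 𝓘(ℝ, F) (m + 1 : ℕ) (Function.uncurry f) (U ×ˢ univ))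
    {a : E} (ha : a ∈ U) (p : N) : HasFDerivAt (f · p) (fderiv ℝ (f · p) a) a := by
  have h1 : ContMDiffAt (𝓘(ℝ, E).prod I) 𝓘(ℝ, F) (m + 1 : ℕ) (Function.uncurry f) (a, p) :=
    hf.contMDiffAt ((hU.prod isOpen_univ).mem_nhds ⟨ha, mem_univ _⟩)
  have h2 : ContMDiffAt 𝓘(ℝ, E) 𝓘(ℝ, F) (m + 1 : ℕ) (f · p) a :=
    h1.comp (x := a) (f := fun b : E => (b, p)) (contMDiffAt_id.prodMk contMDiffAt_const)
  exact (h2.contDiffAt.differentiableAt (by simp)).hasFDerivAt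

theorem continuousOn_uncurry_comp_right {A B C V : Type*} [TopologicalSpace A]
    [TopologicalSpace B] [TopologicalSpace C] [TopologicalSpace V] {s : Set A} {g : A → B → V}
    (hg : ContinuousOn (Function.uncurry g) (s ×ˢ univ)) {j : C → B} (hj : Continuous j) :
    ContinuousOn (Function.uncurry fun a c => g a (j c)) (s ×ˢ univ) :=
  hg.comp (f := fun q : A × C => (q.1, j q.2)) (by fun_prop) fun _ hq => ⟨hq.1, mem_univ _⟩

/-- Averaging a `C²` function over a compact family of parameters yields a `C²` function. -/
theorem contDiffOn_two_integral [FiniteDimensional ℝ E] [IsManifold I 1 N] (hU : IsOpen U)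
    {f : E → N → F} {j : P → N} (hj : Continuous j)
    (hf : ContMDiffOn (𝓘(ℝ, E).prod I) 𝓘(ℝ, F) 2 (Function.uncurry f) (U ×ˢ univ)) :
    ContDiffOn ℝ 2 (fun a => ∫ p, f a (j p) ∂μ) U := by
  have hf1 := contMDiffOn_fderiv_left hU (m := 1) hf
  have hf2 := contMDiffOn_fderiv_left hU (m := 0) hf1
  have key1 : ∀ a ∈ U, HasFDerivAt (fun a => ∫ p, f a (j p) ∂μ)
      (∫ p, fderiv ℝ (f · (j p)) a ∂μ) a := fun a ha =>
    hasFDerivAt_integral_of_compactSpace μ hU (continuousOn_uncurry_comp_right hf.continuousOn hj)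
      (continuousOn_uncurry_comp_right hf1.continuousOn hj)
      (fun b hb p => hasFDerivAt_fderiv_left hU (m := 1) hf hb (j p)) ha
  have key2 : ∀ a ∈ U, HasFDerivAt (fun a => ∫ p, fderiv ℝ (f · (j p)) a ∂μ)
      (∫ p, fderiv ℝ (fun b => fderiv ℝ (f · (j p)) b) a ∂μ) a := fun a ha =>
    hasFDerivAt_integral_of_compactSpace μ hU (continuousOn_uncurry_comp_right hf1.continuousOn hj)
      (continuousOn_uncurry_comp_right hf2.continuousOn hj)
      (fun b hb p => hasFDerivAt_fderiv_left hU (m := 0) hf1 hb (j p)) ha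
  have c2 : ContinuousOn (fun a => ∫ p, fderiv ℝ (fun b => fderiv ℝ (f · (j p)) b) a ∂μ) U :=
    continuousOn_integral_of_compactSpace μ (continuousOn_uncurry_comp_right hf2.continuousOn hj)
  have d1 : ContDiffOn ℝ 1 (fun a => ∫ p, fderiv ℝ (f · (j p)) a ∂μ) U := by
    rw [show (1 : ℕ∞ω) = 0 + 1 by simp, contDiffOn_succ_iff_fderiv_of_isOpen hU]
    refine ⟨fun a ha => (key2 a ha).differentiableAt.differentiableWithinAt, by simp, ?_⟩
    exact contDiffOn_zero.mpr (c2.congr fun a ha => (key2 a ha).fderiv)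
  rw [show (2 : ℕ∞ω) = 1 + 1 by norm_num, contDiffOn_succ_iff_fderiv_of_isOpen hU]
  exact ⟨fun a ha => (key1 a ha).differentiableAt.differentiableWithinAt, by simp,
    d1.congr fun a ha => (key1 a ha).fderiv⟩

end ParametricIntegral

/-! ### Functions on a Lie group that are invariant under a compact subgroup -/

section CosetFunctions

variable {E : Type*} [NormedAddCommGroup E] [NormedSpace ℝ E]
  {M : Type*} [TopologicalSpace M] (I : ModelWithCorners ℝ E M)
  {G : Type*} [Group G] [TopologicalSpace G] [ChartedSpace M G]
  {F : Type*} [NormedAddCommGroup F] [NormedSpace ℝ F]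
  {F' : Type*} [NormedAddCommGroup F'] [NormedSpace ℝ F']

/-- A `C²` function on `G` that is invariant under right translation by elements of `H`, i.e.
a `C²` function on the coset space `G/H`, without reference to a manifold structure on `G/H`. -/
structure IsCosetFunction (H : Subgroup G) (ψ : G → F) : Prop where
  contMDiff : ContMDiff I 𝓘(ℝ, F) 2 ψ
  mul_right : ∀ g, ∀ h ∈ H, ψ (g * h) = ψ g

variable {I} {H : Subgroup G}

namespace IsCosetFunction

theorem eq_one {ψ : G → F} (hψ : IsCosetFunction I H ψ) {h : G} (hh : h ∈ H) : ψ h = ψ 1 := by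
  simpa using hψ.mul_right 1 h hh

theorem comp_mul_left [LieGroup I ∞ G] {ψ : G → F} (hψ : IsCosetFunction I H ψ) (x : G) :
    IsCosetFunction I H fun g => ψ (x * g) where
  contMDiff := hψ.contMDiff.comp (contMDiff_mul_left (I := I) (n := 2) (a := x))
  mul_right g h hh := by rw [← mul_assoc, hψ.mul_right _ h hh]

/-- Conjugation by `c` preserves coset functions when `c * H * c⁻¹ ⊆ H`. -/
theorem comp_conj [LieGroup I ∞ G] {ψ : G → F} (hψ : IsCosetFunction I H ψ) {c : G}
    (hc : ∀ h ∈ H, c * h * c⁻¹ ∈ H) : IsCosetFunction I H fun g => ψ (c * g * c⁻¹) where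
  contMDiff := hψ.contMDiff.comp
    ((contMDiff_mul_right (I := I) (n := 2) (a := c⁻¹)).comp
      (contMDiff_mul_left (I := I) (n := 2) (a := c)))
  mul_right g h hh := by
    rw [show c * (g * h) * c⁻¹ = c * g * c⁻¹ * (c * h * c⁻¹) by group, hψ.mul_right _ _ (hc h hh)]

theorem clm_comp {ψ : G → F} (hψ : IsCosetFunction I H ψ) (L : F →L[ℝ] F') :
    IsCosetFunction I H fun g => L (ψ g) where
  contMDiff := L.contMDiff.comp hψ.contMDiff
  mul_right g h hh := by rw [hψ.mul_right g h hh]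

theorem sub_const {ψ : G → F} (hψ : IsCosetFunction I H ψ) (c : F) :
    IsCosetFunction I H fun g => ψ g - c where
  contMDiff := hψ.contMDiff.sub contMDiff_const
  mul_right g h hh := by rw [hψ.mul_right g h hh]

theorem pi {ι : Type*} [Fintype ι] {ψ : ι → G → F} (hψ : ∀ i, IsCosetFunction I H (ψ i)) :
    IsCosetFunction I H fun g i => ψ i g where
  contMDiff := contMDiff_pi_space.mpr fun i => (hψ i).contMDiff
  mul_right g h hh := by funext i; exact (hψ i).mul_right g h hh

end IsCosetFunction

theorem t2Space_of_lieGroup (I : ModelWithCorners ℝ E M) [LieGroup I ∞ G] : T2Space G :=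
  have := topologicalGroup_of_lieGroup (G := G) I ∞
  have : T1Space G := I.t1Space G
  inferInstance

/-- The average of a smooth function over a compact subgroup. -/
theorem isCosetFunction_integral [FiniteDimensional ℝ E] [I.Boundaryless] [LieGroup I ∞ G]
    [CompactSpace H] [MeasurableSpace H] [BorelSpace H] (μ : Measure H) [IsFiniteMeasure μ]
    [μ.IsMulLeftInvariant] {b : G → ℝ} (hb : ContMDiff I 𝓘(ℝ) ∞ b) :
    IsCosetFunction I H fun g => ∫ h : H, b (g * h) ∂μ where
  contMDiff := by
    intro x
    have hf : ContMDiffOn (𝓘(ℝ, E).prod I) 𝓘(ℝ) 2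
        (Function.uncurry fun (a : E) (n : G) => b ((extChartAt I x).symm a * n))
        ((extChartAt I x).target ×ˢ univ) := by
      refine (hb.of_le ENat.LEInfty.out).comp_contMDiffOn ?_
      refine ContMDiffOn.mul (I := I) (n := 2) ?_ contMDiffOn_snd
      exact (contMDiffOn_extChartAt_symm x).comp contMDiffOn_fst fun q hq => hq.1
    have h1 := contDiffOn_two_integral μ (isOpen_extChartAt_target x)
      (continuous_subtype_val (p := fun g => g ∈ H)) hf
    have h2 : ContDiffAt ℝ 2
        (fun a => ∫ h : H, b ((extChartAt I x).symm a * h) ∂μ) (extChartAt I x x) :=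
      h1.contDiffAt (extChartAt_target_mem_nhds x)
    refine (h2.contMDiffAt.comp x
      (contMDiffAt_extChartAt (I := I) (n := 2))).congr_of_eventuallyEq ?_
    filter_upwards [extChartAt_source_mem_nhds (I := I) x] with g hg
    simp only [Function.comp_apply, (extChartAt I x).left_inv hg]
  mul_right g h hh := by
    have := topologicalGroup_of_lieGroup (G := G) I ∞
    have := integral_mul_left_eq_self (μ := μ) (fun k : H => b (g * k)) ⟨h, hh⟩
    simpa [mul_assoc] using this

/-- Coset functions separate the points of `G/H`: average a bump function at `1` whose support is
disjoint from a given coset `xH ≠ H`. -/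
theorem exists_isCosetFunction_ne_one [FiniteDimensional ℝ E] [I.Boundaryless] [LieGroup I ∞ G]
    (hH : IsCompact (H : Set G)) {x : G} (hx : x ∉ H) :
    ∃ ψ : G → ℝ, IsCosetFunction I H ψ ∧ ψ x ≠ ψ 1 := by
  have := topologicalGroup_of_lieGroup (G := G) I ∞
  have := t2Space_of_lieGroup (G := G) I
  have : CompactSpace H := isCompact_iff_compactSpace.mp hH
  let : MeasurableSpace H := borel H
  have : BorelSpace H := ⟨rfl⟩
  let μ : Measure H := Measure.haar
  have hcl : IsClosed ((x * ·) '' (H : Set G)) := (hH.image (continuous_const_mul x)).isClosed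
  have hnot : (1 : G) ∉ (x * ·) '' (H : Set G) := by
    rintro ⟨h, hh, h1⟩
    exact hx (by rw [eq_inv_of_mul_eq_one_left h1]; exact H.inv_mem hh)
  obtain ⟨b, -, hb⟩ := (SmoothBumpFunction.nhds_basis_support (I := I)
    (hcl.isOpen_compl.mem_nhds hnot)).mem_iff.mp (hcl.isOpen_compl.mem_nhds hnot)
  have hψ := isCosetFunction_integral (I := I) (H := H) μ b.contMDiff
  refine ⟨_, hψ, ?_⟩
  have h0 : ∫ h : H, b (x * h) ∂μ = 0 := by
    refine integral_eq_zero_of_ae (Eventually.of_forall fun h => ?_)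
    by_contra h1
    exact hb (show x * (h : G) ∈ Function.support b from h1) ⟨h, h.2, rfl⟩
  have hc : Continuous fun h : H => b (1 * h) :=
    b.continuous.comp (continuous_const.mul continuous_subtype_val)
  have h1 : 0 < ∫ h : H, b (1 * h) ∂μ :=
    hc.integral_pos_of_hasCompactSupport_nonneg_nonzero (HasCompactSupport.of_compactSpace _)
      (fun h => b.nonneg) (x := 1) (by simp)
  rw [h0]
  exact h1.ne

end CosetFunctions

/-! ### Coordinates at the identity and uniform Taylor estimates -/

section Coordinates

variable {E : Type*} [NormedAddCommGroup E] [NormedSpace ℝ E]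
  {M : Type*} [TopologicalSpace M] (I : ModelWithCorners ℝ E M)
  {G : Type*} [Group G] [TopologicalSpace G] [ChartedSpace M G]

/-- The chart of `G` at `1`, translated so that it maps `1` to `0`. -/
noncomputable def coordOne (g : G) : E := extChartAt I (1 : G) g - extChartAt I (1 : G) 1

variable (G) in
/-- The local parametrization of `G` near `1` inverse to `coordOne`. It plays the role of the
exponential map. -/
noncomputable def paramOne (v : E) : G := (extChartAt I (1 : G)).symm (v + extChartAt I (1 : G) 1)

@[simp] theorem coordOne_one : coordOne I (1 : G) = 0 := sub_self _

@[simp] theorem paramOne_zero : paramOne I G 0 = 1 := by simp [paramOne]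

theorem eventually_paramOne_coordOne : ∀ᶠ g in 𝓝 (1 : G), paramOne I G (coordOne I g) = g := by
  filter_upwards [extChartAt_source_mem_nhds (I := I) (1 : G)] with g hg
  rw [paramOne, coordOne, sub_add_cancel, (extChartAt I (1 : G)).left_inv hg]

theorem contMDiffAt_coordOne [IsManifold I ∞ G] : ContMDiffAt I 𝓘(ℝ, E) ∞ (coordOne I) (1 : G) :=
  contMDiffAt_extChartAt.sub contMDiffAt_const

variable (G) in
theorem tendsto_coordOne [IsManifold I ∞ G] : Tendsto (coordOne I) (𝓝 (1 : G)) (𝓝 0) := by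
  simpa using (contMDiffAt_coordOne (G := G) I).continuousAt.tendsto

variable [I.Boundaryless]

variable (G) in
theorem exists_isOpen_contMDiffOn_paramOne [IsManifold I ∞ G] :
    ∃ U : Set E, IsOpen U ∧ 0 ∈ U ∧ ContMDiffOn 𝓘(ℝ, E) I ∞ (paramOne I G) U := by
  refine ⟨(fun v => v + extChartAt I (1 : G) 1) ⁻¹' (extChartAt I (1 : G)).target,
    (isOpen_extChartAt_target (1 : G)).preimage (by fun_prop), by simp, ?_⟩
  refine (contMDiffOn_extChartAt_symm (1 : G)).comp (t := (extChartAt I (1 : G)).target) ?_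
    (fun v hv => hv)
  exact (contDiff_id.add contDiff_const).contMDiff.contMDiffOn

variable (G) in
theorem contMDiffAt_paramOne [IsManifold I ∞ G] : ContMDiffAt 𝓘(ℝ, E) I ∞ (paramOne I G) 0 := by
  obtain ⟨U, hU, h0, h⟩ := exists_isOpen_contMDiffOn_paramOne I G
  exact h.contMDiffAt (hU.mem_nhds h0)

variable (G) in
theorem eventually_contMDiffAt_paramOne [IsManifold I ∞ G] :
    ∀ᶠ v in 𝓝 (0 : E), ContMDiffAt 𝓘(ℝ, E) I ∞ (paramOne I G) v := by
  obtain ⟨U, hU, h0, h⟩ := exists_isOpen_contMDiffOn_paramOne I G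
  filter_upwards [hU.mem_nhds h0] with v hv using h.contMDiffAt (hU.mem_nhds hv)

variable (G) in
theorem eventually_coordOne_paramOne : ∀ᶠ v in 𝓝 (0 : E), coordOne I (paramOne I G v) = v := by
  have h : (fun v => v + extChartAt I (1 : G) 1) ⁻¹' (extChartAt I (1 : G)).target ∈ 𝓝 (0 : E) :=
    ((isOpen_extChartAt_target (1 : G)).preimage (by fun_prop)).mem_nhds (by simp)
  filter_upwards [h] with v hv
  rw [paramOne, coordOne, (extChartAt I (1 : G)).right_inv hv, add_sub_cancel_right]

variable (G) in
theorem tendsto_paramOne [IsManifold I ∞ G] : Tendsto (paramOne I G) (𝓝 0) (𝓝 1) := by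
  simpa using (contMDiffAt_paramOne I G).continuousAt.tendsto

end Coordinates

section Taylor

/-- A `C²` bound on the first order Taylor remainder at `0`. -/
theorem norm_sub_sub_fderiv_zero_le {E F : Type*} [NormedAddCommGroup E] [NormedSpace ℝ E]
    [NormedAddCommGroup F] [NormedSpace ℝ F] {f : E → F} {f' : E → E →L[ℝ] F}
    {f'' : E → E →L[ℝ] E →L[ℝ] F} {r C : ℝ}
    (hf : ∀ v ∈ Metric.ball (0 : E) r, HasFDerivAt f (f' v) v)
    (hf' : ∀ v ∈ Metric.ball (0 : E) r, HasFDerivAt f' (f'' v) v)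
    (hC : ∀ v ∈ Metric.ball (0 : E) r, ‖f'' v‖ ≤ C) {w : E} (hw : w ∈ Metric.ball (0 : E) r) :
    ‖f w - f 0 - f' 0 w‖ ≤ C * ‖w‖ ^ 2 := by
  have h0 : (0 : E) ∈ Metric.ball (0 : E) r := by
    simpa using (norm_nonneg w).trans_lt (by simpa using hw)
  have hseg : segment ℝ 0 w ⊆ Metric.ball (0 : E) r := (convex_ball _ _).segment_subset h0 hw
  have hC0 : 0 ≤ C := (norm_nonneg (f'' 0)).trans (hC 0 h0)
  have hlip : ∀ v ∈ segment ℝ 0 w, ‖f' v - f' 0‖ ≤ C * ‖w‖ := by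
    intro v hv
    have h1 : ‖f' v - f' 0‖ ≤ C * ‖v - 0‖ :=
      (convex_ball (0 : E) r).norm_image_sub_le_of_norm_hasFDerivWithin_le
        (fun u hu => (hf' u hu).hasFDerivWithinAt) hC h0 (hseg hv)
    obtain ⟨a, b, ha, hb, hab, rfl⟩ := hv
    refine h1.trans (mul_le_mul_of_nonneg_left ?_ hC0)
    rw [smul_zero, zero_add, sub_zero, norm_smul, Real.norm_of_nonneg hb]
    exact mul_le_of_le_one_left (norm_nonneg w) (by linarith)
  have h2 := (convex_segment (0 : E) w).norm_image_sub_le_of_norm_hasFDerivWithin_le'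
    (f := f) (f' := f') (φ := f' 0) (C := C * ‖w‖)
    (fun u hu => (hf u (hseg hu)).hasFDerivWithinAt) hlip (left_mem_segment ℝ 0 w)
    (right_mem_segment ℝ 0 w)
  simpa [pow_two, mul_assoc] using h2

variable {E : Type*} [NormedAddCommGroup E] [NormedSpace ℝ E]
  {M : Type*} [TopologicalSpace M] {I : ModelWithCorners ℝ E M}
  {G : Type*} [Group G] [TopologicalSpace G] [ChartedSpace M G] [LieGroup I ∞ G]
  {F : Type*} [NormedAddCommGroup F] [NormedSpace ℝ F]

/-- The derivative at `0` of `w ↦ ψ (x * paramOne w)`: the differential of `ψ` at `x` in the left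
trivialization of the tangent bundle of `G`. -/
noncomputable def leftDeriv (I : ModelWithCorners ℝ E M) (ψ : G → F) (x : G) : E →L[ℝ] F :=
  fderiv ℝ (fun w => ψ (x * paramOne I G w)) 0

theorem contMDiffOn_mul_paramOne {ψ : G → F} (hψ : ContMDiff I 𝓘(ℝ, F) 2 ψ) {U : Set E}
    (hU : ContMDiffOn 𝓘(ℝ, E) I ∞ (paramOne I G) U) :
    ContMDiffOn (𝓘(ℝ, E).prod I) 𝓘(ℝ, F) 2
      (Function.uncurry fun (w : E) (x : G) => ψ (x * paramOne I G w)) (U ×ˢ univ) := by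
  refine hψ.comp_contMDiffOn (ContMDiffOn.mul (I := I) (n := 2) contMDiffOn_snd ?_)
  exact (hU.of_le ENat.LEInfty.out).comp contMDiffOn_fst fun q hq => hq.1

theorem continuous_leftDeriv [I.Boundaryless] {ψ : G → F} (hψ : ContMDiff I 𝓘(ℝ, F) 2 ψ) :
    Continuous (leftDeriv I ψ) := by
  obtain ⟨U, hU, h0, h⟩ := exists_isOpen_contMDiffOn_paramOne I G
  have h1 := (contMDiffOn_fderiv_left hU (m := 1) (contMDiffOn_mul_paramOne hψ h)).continuousOn
  exact h1.comp_continuous (by fun_prop : Continuous fun x : G => ((0 : E), x))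
    fun x => ⟨h0, mem_univ _⟩

theorem hasFDerivAt_leftDeriv [I.Boundaryless] {ψ : G → F} (hψ : ContMDiff I 𝓘(ℝ, F) 2 ψ) (x : G) :
    HasFDerivAt (fun w => ψ (x * paramOne I G w)) (leftDeriv I ψ x) 0 := by
  obtain ⟨U, hU, h0, h⟩ := exists_isOpen_contMDiffOn_paramOne I G
  exact hasFDerivAt_fderiv_left hU (m := 1) (contMDiffOn_mul_paramOne hψ h) h0 x

/-- The Taylor estimate for `w ↦ ψ (x * paramOne w)` is locally uniform in `x`. -/
theorem exists_taylor_bound [I.Boundaryless] {ψ : G → F} (hψ : ContMDiff I 𝓘(ℝ, F) 2 ψ) (x₀ : G) :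
    ∃ C : ℝ, ∃ r > 0, ∀ᶠ x in 𝓝 x₀, ∀ w : E, ‖w‖ < r →
      ‖ψ (x * paramOne I G w) - ψ x - leftDeriv I ψ x w‖ ≤ C * ‖w‖ ^ 2 := by
  obtain ⟨U, hU, h0, h⟩ := exists_isOpen_contMDiffOn_paramOne I G
  have hf := contMDiffOn_mul_paramOne hψ h
  have hf1 := contMDiffOn_fderiv_left hU (m := 1) hf
  have hf2 := contMDiffOn_fderiv_left hU (m := 0) hf1
  have hc := (hf2.continuousOn.continuousAt
    ((hU.prod isOpen_univ).mem_nhds (show ((0 : E), x₀) ∈ U ×ˢ univ from ⟨h0, mem_univ _⟩))).norm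
  obtain ⟨C, hC⟩ := exists_gt ‖fderiv ℝ (fun v => fderiv ℝ (fun w => ψ (x₀ * paramOne I G w)) v) 0‖
  have hb := hc.eventually (gt_mem_nhds hC)
  rw [nhds_prod_eq, eventually_prod_iff] at hb
  obtain ⟨p, hp, q, hq, hpq⟩ := hb
  obtain ⟨r, hr, hrU⟩ := Metric.mem_nhds_iff.mp (inter_mem hp (hU.mem_nhds h0))
  refine ⟨C, r, hr, ?_⟩
  filter_upwards [hq] with x hx w hw
  have := norm_sub_sub_fderiv_zero_le (r := r)
    (fun v hv => hasFDerivAt_fderiv_left hU (m := 1) hf (hrU hv).2 x)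
    (fun v hv => hasFDerivAt_fderiv_left hU (m := 0) hf1 (hrU hv).2 x)
    (fun v hv => (hpq (hrU hv).1 hx).le) (w := w) (by simpa using hw)
  simpa [leftDeriv] using this

end Taylor

/-! ### The infinitesimal stabilizer and straightened coordinates -/

section LeftDeriv

variable {E : Type*} [NormedAddCommGroup E] [NormedSpace ℝ E]
  {M : Type*} [TopologicalSpace M] {I : ModelWithCorners ℝ E M} [I.Boundaryless]
  {G : Type*} [Group G] [TopologicalSpace G] [ChartedSpace M G] [LieGroup I ∞ G]
  {F : Type*} [NormedAddCommGroup F] [NormedSpace ℝ F]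
  {F' : Type*} [NormedAddCommGroup F'] [NormedSpace ℝ F']

theorem leftDeriv_clm_comp {ψ : G → F} (hψ : ContMDiff I 𝓘(ℝ, F) 2 ψ) (L : F →L[ℝ] F') (x : G) :
    leftDeriv I (fun g => L (ψ g)) x = L ∘L leftDeriv I ψ x :=
  (L.hasFDerivAt.comp (0 : E) (hasFDerivAt_leftDeriv hψ x)).fderiv

omit [I.Boundaryless] [LieGroup I ∞ G] in
theorem leftDeriv_comp_mul_left (ψ : G → F) (x : G) :
    leftDeriv I (fun g => ψ (x * g)) 1 = leftDeriv I ψ x := by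
  simp [leftDeriv]

omit [LieGroup I ∞ G] in
variable (I G) in
/-- The differential at `v` of `u ↦ (paramOne v)⁻¹ * paramOne u` in the coordinates `coordOne`. -/
noncomputable def leftTransport (v : E) : E →L[ℝ] E :=
  fderiv ℝ (fun u => coordOne I ((paramOne I G v)⁻¹ * paramOne I G u)) v

theorem hasFDerivAt_comp_paramOne {ψ : G → F} (hψ : ContMDiff I 𝓘(ℝ, F) 2 ψ) {v : E}
    (hv : ContMDiffAt 𝓘(ℝ, E) I ∞ (paramOne I G) v) :
    HasFDerivAt (fun u => ψ (paramOne I G u))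
      (leftDeriv I ψ (paramOne I G v) ∘L leftTransport I G v) v := by
  set x := paramOne I G v with hx
  have h1 : ContMDiffAt 𝓘(ℝ, E) I ∞ (fun u => x⁻¹ * paramOne I G u) v :=
    (contMDiff_mul_left (I := I) (n := ∞) (a := x⁻¹)).contMDiffAt.comp v hv
  have h1v : x⁻¹ * paramOne I G v = 1 := by rw [hx, inv_mul_cancel]
  have h2 : ContMDiffAt 𝓘(ℝ, E) 𝓘(ℝ, E) ∞ (fun u => coordOne I (x⁻¹ * paramOne I G u)) v :=
    ContMDiffAt.comp (I' := I) v (g := coordOne I) (by rw [h1v]; exact contMDiffAt_coordOne I) h1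
  have h3 : HasFDerivAt (fun u => coordOne I (x⁻¹ * paramOne I G u)) (leftTransport I G v) v :=
    (h2.contDiffAt.differentiableAt (by simp)).hasFDerivAt
  have h4 : HasFDerivAt (fun w => ψ (x * paramOne I G w)) (leftDeriv I ψ x)
      (coordOne I (x⁻¹ * paramOne I G v)) := by
    rw [h1v, coordOne_one]
    exact hasFDerivAt_leftDeriv hψ x
  refine (h4.comp v h3).congr_of_eventuallyEq ?_
  have h5 : Tendsto (fun u => x⁻¹ * paramOne I G u) (𝓝 v) (𝓝 1) := by
    simpa only [h1v] using h1.continuousAt.tendsto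
  filter_upwards [h5.eventually (eventually_paramOne_coordOne (G := G) I)] with u hu
  simp [hu]

end LeftDeriv

section Stabilizer

variable {E : Type*} [NormedAddCommGroup E] [NormedSpace ℝ E]
  {M : Type*} [TopologicalSpace M] (I : ModelWithCorners ℝ E M)
  {G : Type*} [Group G] [TopologicalSpace G] [ChartedSpace M G]
  (H : Subgroup G)
  {F : Type*} [NormedAddCommGroup F] [NormedSpace ℝ F]

/-- The directions at `1` along which all coset functions have vanishing derivative. For compact
`H` this is the Lie algebra of `H`. -/
def infinitesimalStabilizer : Submodule ℝ E where
  carrier := {v | ∀ ψ : G → ℝ, IsCosetFunction I H ψ → leftDeriv I ψ 1 v = 0}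
  add_mem' ha hb ψ hψ := by rw [map_add, ha ψ hψ, hb ψ hψ, add_zero]
  zero_mem' ψ _ := map_zero _
  smul_mem' c a ha ψ hψ := by rw [map_smul, ha ψ hψ, smul_zero]

variable {I H} [I.Boundaryless] [LieGroup I ∞ G]

theorem IsCosetFunction.leftDeriv_eq_zero {ψ : G → F} (hψ : IsCosetFunction I H ψ) (x : G) {v : E}
    (hv : v ∈ infinitesimalStabilizer I H) : leftDeriv I ψ x v = 0 := by
  refine (SeparatingDual.eq_zero_iff_forall_dual_eq_zero (R := ℝ) _).mpr fun L => ?_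
  have h := hv _ ((hψ.comp_mul_left x).clm_comp L)
  rw [leftDeriv_comp_mul_left (fun g => L (ψ g)) x, leftDeriv_clm_comp hψ.contMDiff L x] at h
  exact h

theorem inv_mul_mem_of_forall_isCosetFunction [FiniteDimensional ℝ E]
    (hH : IsCompact (H : Set G)) {x y : G}
    (h : ∀ ψ : G → ℝ, IsCosetFunction I H ψ → ψ x = ψ y) : x⁻¹ * y ∈ H := by
  by_contra hxy
  obtain ⟨ψ, hψ, hne⟩ := exists_isCosetFunction_ne_one (I := I) hH hxy
  exact hne (by simpa using (h _ (hψ.comp_mul_left x⁻¹)).symm)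

variable (I H) in
/-- Finitely many coset functions, assembled into a vector-valued one, have a derivative at `1`
whose kernel is exactly the infinitesimal stabilizer; after a linear change of the target this
derivative is a projection. -/
theorem exists_isCosetFunction_leftDeriv_projection [FiniteDimensional ℝ E] :
    ∃ (π : E →L[ℝ] E) (Θ : G → E), IsCosetFunction I H Θ ∧ leftDeriv I Θ 1 = π ∧ Θ 1 = 0 ∧
      (∀ g, π (Θ g) = Θ g) ∧ (∀ v, π (π v) = π v) ∧
      ∀ v, π v = 0 ↔ v ∈ infinitesimalStabilizer I H := by
  obtain ⟨m, hm⟩ := (infinitesimalStabilizer I H).exists_isCompl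
  -- The restrictions to `m` of the derivatives at `1` of coset functions form a subspace of the
  -- dual of `m` that separates points, hence the whole dual.
  let A : Submodule ℝ (Module.Dual ℝ m) :=
    { carrier := {l | ∃ ψ : G → ℝ, IsCosetFunction I H ψ ∧
        ∀ w : m, l w = leftDeriv I ψ 1 (w : E)}
      add_mem' := by
        rintro a b ⟨ψ, hψ, ha⟩ ⟨χ, hχ, hb⟩
        refine ⟨fun g => ψ g + χ g, ⟨hψ.contMDiff.add hχ.contMDiff, fun g h hh => by
          rw [hψ.mul_right g h hh, hχ.mul_right g h hh]⟩, fun w => ?_⟩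
        rw [LinearMap.add_apply, ha, hb]
        have := ((hasFDerivAt_leftDeriv hψ.contMDiff 1).add
          (hasFDerivAt_leftDeriv hχ.contMDiff 1)).fderiv
        exact (congrArg (fun L : E →L[ℝ] ℝ => L w) this).symm
      zero_mem' := ⟨fun _ => 0, ⟨contMDiff_const, fun _ _ _ => rfl⟩, fun w => by
        simp [leftDeriv]⟩
      smul_mem' := by
        rintro c a ⟨ψ, hψ, ha⟩
        refine ⟨_, hψ.clm_comp (c • ContinuousLinearMap.id ℝ ℝ), fun w => ?_⟩
        rw [leftDeriv_clm_comp hψ.contMDiff]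
        simp [ha] }
  have hA : A = ⊤ := by
    have h0 : A.dualCoannihilator = ⊥ := by
      rw [eq_bot_iff]
      intro w hw
      have hw' : (w : E) ∈ infinitesimalStabilizer I H := by
        intro ψ hψ
        exact (Submodule.mem_dualCoannihilator _).mp hw
          ((leftDeriv I ψ 1 : E →ₗ[ℝ] ℝ) ∘ₗ m.subtype) ⟨ψ, hψ, fun _ => rfl⟩
      have : (w : E) ∈ (⊥ : Submodule ℝ E) := hm.inf_eq_bot ▸ ⟨hw', w.2⟩
      simpa using this
    rw [← Subspace.dualCoannihilator_dualAnnihilator_eq (W := A), h0,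
      Submodule.dualAnnihilator_bot]
  let b := Module.finBasis ℝ m
  have hb : ∀ i, ∃ ψ : G → ℝ, IsCosetFunction I H ψ ∧
      ∀ w : m, b.coord i w = leftDeriv I ψ 1 (w : E) := fun i =>
    (hA ▸ Submodule.mem_top : b.coord i ∈ A)
  choose ψ hψ hψb using hb
  let L : (Fin (Module.finrank ℝ m) → ℝ) →L[ℝ] E :=
    LinearMap.toContinuousLinearMap
      (m.subtype ∘ₗ (b.equivFun.symm : (Fin (Module.finrank ℝ m) → ℝ) →ₗ[ℝ] m))
  have hΨ := IsCosetFunction.pi hψ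
  have hLmem : ∀ c, L c ∈ m := fun c => (b.equivFun.symm c).2
  let π := leftDeriv I (fun g => L (fun i => ψ i g)) 1
  have hπ : ∀ v, π v = L (leftDeriv I (fun g i => ψ i g) 1 v) := fun v => by
    change leftDeriv I (fun g => L (fun i => ψ i g)) 1 v = _
    rw [leftDeriv_clm_comp (ψ := fun g i => ψ i g) hΨ.contMDiff]; rfl
  have hπm : ∀ w ∈ m, π w = w := by
    intro w hw
    have h1 : leftDeriv I (fun g i => ψ i g) 1 w = b.equivFun ⟨w, hw⟩ := by
      funext i
      have := leftDeriv_clm_comp (ψ := fun g i => ψ i g) hΨ.contMDiff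
        (ContinuousLinearMap.proj (R := ℝ) (φ := fun _ => ℝ) i) 1
      have := congrArg (fun T : E →L[ℝ] ℝ => T w) this
      simp only [ContinuousLinearMap.proj_apply, ContinuousLinearMap.comp_apply] at this
      rw [← this, ← hψb i ⟨w, hw⟩]
      rfl
    rw [hπ, h1]
    change ((b.equivFun.symm (b.equivFun ⟨w, hw⟩) : m) : E) = w
    rw [LinearEquiv.symm_apply_apply]
  have hπh : ∀ v ∈ infinitesimalStabilizer I H, π v = 0 := fun v hv =>
    (hΨ.clm_comp L).leftDeriv_eq_zero 1 hv
  have hL1 : leftDeriv I (fun g => L (fun i => ψ i g) - L (fun i => ψ i 1)) 1 = π := by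
    exact ((hasFDerivAt_leftDeriv (hΨ.clm_comp L).contMDiff 1).sub_const _).fderiv
  have hpp : ∀ v, π (π v) = π v := fun v => hπm _ (by rw [hπ]; exact hLmem _)
  refine ⟨π, fun g => L (fun i => ψ i g) - L (fun i => ψ i 1),
    (hΨ.clm_comp L).sub_const _, hL1, sub_self _, fun g => hπm _ (m.sub_mem (hLmem _) (hLmem _)),
    hpp, fun v => ⟨fun hv => ?_, hπh v⟩⟩
  obtain ⟨y, z, hy, hz, rfl⟩ := Submodule.codisjoint_iff_exists_add_eq.mp hm.codisjoint v
  rw [map_add, hπh y hy, hπm z hz, zero_add] at hv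
  rwa [hv, add_zero]

end Stabilizer

section StraightCoords

variable {E : Type*} [NormedAddCommGroup E] [NormedSpace ℝ E]
  {M : Type*} [TopologicalSpace M] (I : ModelWithCorners ℝ E M)
  {G : Type*} [Group G] [TopologicalSpace G] [ChartedSpace M G]
  (H : Subgroup G)

/-- Coordinates of `G` near `1` adapted to the fibration `G → G/H`. The coset function `map` takes
values in the range of the projection `proj`, whose kernel is the infinitesimal stabilizer, and
`inv` is a local inverse of `v ↦ map (paramOne v) + (v - proj v)`. -/
structure StraightCoords where
  /-- A projection with kernel the infinitesimal stabilizer. -/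
  proj : E →L[ℝ] E
  /-- A coset function with values in the range of `proj` and derivative `proj` at `1`. -/
  map : G → E
  /-- The local parametrization of the chart at `1` by straightened coordinates. -/
  inv : E → E
  isCosetFunction : IsCosetFunction I H map
  leftDeriv_one : leftDeriv I map 1 = proj
  map_one : map 1 = 0
  proj_map : ∀ g, proj (map g) = map g
  proj_proj : ∀ v, proj (proj v) = proj v
  proj_eq_zero_iff : ∀ v, proj v = 0 ↔ v ∈ infinitesimalStabilizer I H
  inv_zero : inv 0 = 0
  contDiffAt_inv : ContDiffAt ℝ 2 inv 0
  hasStrictFDerivAt_inv : HasStrictFDerivAt inv (ContinuousLinearMap.id ℝ E) 0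
  eventually_inv_left :
    ∀ᶠ v in 𝓝 0, inv (map (paramOne I G v) + (v - proj v)) = v
  eventually_inv_right :
    ∀ᶠ q in 𝓝 0, map (paramOne I G (inv q)) + (inv q - proj (inv q)) = q

variable [FiniteDimensional ℝ E] [I.Boundaryless] [LieGroup I ∞ G]

theorem nonempty_straightCoords : Nonempty (StraightCoords I H) := by
  obtain ⟨π, Θ, hΘ, hd, h1, hπΘ, hππ, hker⟩ := exists_isCosetFunction_leftDeriv_projection I H
  let Φ : E → E := fun v => Θ (paramOne I G v) + (v - π v)
  have hc : ContDiffAt ℝ 2 Φ 0 := by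
    have h2 : ContMDiffAt 𝓘(ℝ, E) 𝓘(ℝ, E) 2 (fun v => Θ (paramOne I G v)) 0 :=
      hΘ.contMDiff.contMDiffAt.comp (0 : E) ((contMDiffAt_paramOne I G).of_le ENat.LEInfty.out)
    exact h2.contDiffAt.add (contDiffAt_id.sub π.contDiff.contDiffAt)
  have hΦ0 : Φ 0 = 0 := by simp [Φ, h1]
  have hΦd : HasFDerivAt Φ ((ContinuousLinearEquiv.refl ℝ E : E ≃L[ℝ] E) : E →L[ℝ] E) 0 := by
    have h2 : HasFDerivAt (fun v => Θ (paramOne I G v)) π 0 := by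
      simpa [hd] using hasFDerivAt_leftDeriv hΘ.contMDiff 1
    refine (h2.add ((hasFDerivAt_id (0 : E)).sub π.hasFDerivAt)).congr_fderiv ?_
    ext v
    simp
  have hs := hc.hasStrictFDerivAt' hΦd (by simp)
  have hi := hc.to_localInverse hΦd (by simp)
  have hsi := hs.to_localInverse
  have hl := hs.eventually_left_inverse
  have hr := hs.eventually_right_inverse
  have h0 := hs.localInverse_apply_image
  rw [hΦ0] at hi hsi hr h0
  exact ⟨⟨π, Θ, hs.localInverse Φ _ 0, hΘ, hd, h1, hπΘ, hππ, hker, h0, hi, hsi, hl, hr⟩⟩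

variable {I H}

namespace StraightCoords

variable (S : StraightCoords I H)

omit [FiniteDimensional ℝ E] [I.Boundaryless] [LieGroup I ∞ G] in
theorem tendsto_inv : Tendsto S.inv (𝓝 0) (𝓝 0) := by
  simpa [S.inv_zero] using S.contDiffAt_inv.continuousAt.tendsto

omit [FiniteDimensional ℝ E] in
theorem tendsto_paramOne_inv : Tendsto (fun q => paramOne I G (S.inv q)) (𝓝 0) (𝓝 1) :=
  (tendsto_paramOne I G).comp S.tendsto_inv

omit [FiniteDimensional ℝ E] [I.Boundaryless] [LieGroup I ∞ G] in
theorem tendsto_proj : Tendsto S.proj (𝓝 0) (𝓝 0) := by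
  simpa using S.proj.continuous.tendsto 0

omit [FiniteDimensional ℝ E] [I.Boundaryless] [LieGroup I ∞ G] in
/-- The coordinate change `inv` does not affect the component in the infinitesimal stabilizer. -/
theorem eventually_sub_proj_inv :
    ∀ᶠ q in 𝓝 0, S.inv q - S.proj (S.inv q) = q - S.proj q := by
  filter_upwards [S.eventually_inv_right] with q hq
  have h := congrArg (fun v => v - S.proj v) hq
  simpa [S.proj_map, S.proj_proj] using h

omit [FiniteDimensional ℝ E] in
/-- On the range of the projection, the differentials of `map` near `1` are bounded below. -/
theorem eventually_le_norm_leftDeriv :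
    ∀ᶠ x in 𝓝 (1 : G), ∀ w, S.proj w = w → 2⁻¹ * ‖w‖ ≤ ‖leftDeriv I S.map x w‖ := by
  have hc := (continuous_leftDeriv S.isCosetFunction.contMDiff).tendsto 1
  rw [S.leftDeriv_one] at hc
  filter_upwards [Metric.tendsto_nhds.mp hc 2⁻¹ (by norm_num)] with x hx w hw
  have h1 : ‖(leftDeriv I S.map x - S.proj) w‖ ≤ 2⁻¹ * ‖w‖ :=
    (leftDeriv I S.map x - S.proj).le_of_opNorm_le (by rw [← dist_eq_norm]; exact hx.le) w
  have h2 : w = leftDeriv I S.map x w - (leftDeriv I S.map x - S.proj) w := by simp [hw]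
  have h3 : ‖w‖ ≤ ‖leftDeriv I S.map x w‖ + ‖(leftDeriv I S.map x - S.proj) w‖ := by
    conv_lhs => rw [h2]
    exact norm_sub_le _ _
  linarith

omit [FiniteDimensional ℝ E] in
/-- By left invariance, all kernels contain the infinitesimal stabilizer, so that near `1` the map
`map` has constant rank. -/
theorem eventually_mem_infinitesimalStabilizer :
    ∀ᶠ x in 𝓝 (1 : G), ∀ v, leftDeriv I S.map x v = 0 → v ∈ infinitesimalStabilizer I H := by
  filter_upwards [S.eventually_le_norm_leftDeriv] with x hx v hv
  have h1 : v - S.proj v ∈ infinitesimalStabilizer I H := by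
    rw [← S.proj_eq_zero_iff, map_sub, S.proj_proj, sub_self]
  have h2 := S.isCosetFunction.leftDeriv_eq_zero x h1
  rw [map_sub, hv, zero_sub, neg_eq_zero] at h2
  have h3 := hx (S.proj v) (S.proj_proj v)
  rw [h2, norm_zero] at h3
  rw [← S.proj_eq_zero_iff, ← norm_le_zero_iff]
  linarith

omit [FiniteDimensional ℝ E] in
/-- Every coset function depends only on the projection of the straightened coordinates: by the
constant rank property its derivative vanishes along the fibres of `map`. -/
theorem eventually_eq_inv_proj : ∀ᶠ q in 𝓝 (0 : E), ∀ ψ : G → ℝ, IsCosetFunction I H ψ →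
    ψ (paramOne I G (S.inv q)) = ψ (paramOne I G (S.inv (S.proj q))) := by
  have hev := ((((S.tendsto_inv.eventually (eventually_contMDiffAt_paramOne I G)).and
    (S.contDiffAt_inv.eventually (by simp))).and
    (eventually_eventually_nhds.mpr S.eventually_inv_right)).and
    (S.tendsto_paramOne_inv.eventually S.eventually_mem_infinitesimalStabilizer))
  obtain ⟨r, hr, hball⟩ := Metric.eventually_nhds_iff_ball.mp hev
  filter_upwards [Metric.ball_mem_nhds 0 hr,
    S.tendsto_proj.eventually (Metric.ball_mem_nhds 0 hr)] with q hq hπq ψ hψ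
  have key : ∀ p ∈ Metric.ball (0 : E) r, ∃ D : E →L[ℝ] ℝ,
      HasFDerivAt (fun p => ψ (paramOne I G (S.inv p))) D p ∧ ∀ z, S.proj z = 0 → D z = 0 := by
    intro p hp
    obtain ⟨⟨⟨h1, h2⟩, h3⟩, h4⟩ := hball p hp
    have hS : HasFDerivAt S.inv (fderiv ℝ S.inv p) p := (h2.differentiableAt (by simp)).hasFDerivAt
    refine ⟨_, (hasFDerivAt_comp_paramOne hψ.contMDiff h1).comp p hS, fun z hz => ?_⟩
    set u := fderiv ℝ S.inv p z with hu
    have h5 := (hasFDerivAt_comp_paramOne S.isCosetFunction.contMDiff h1)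
    -- Differentiate the identity satisfied by the local inverse.
    have h6 : S.proj (leftDeriv I S.map (paramOne I G (S.inv p)) (leftTransport I G (S.inv p) u))
        = 0 := by
      have h7 := ((h5.add ((hasFDerivAt_id _).sub S.proj.hasFDerivAt)).comp p hS)
      have h8 := h7.unique ((hasFDerivAt_id p).congr_of_eventuallyEq h3)
      have h9 := congrArg (fun L : E →L[ℝ] E => S.proj (L z)) h8
      simpa [S.proj_proj, hz] using h9
    have h10 : leftDeriv I S.map (paramOne I G (S.inv p)) (leftTransport I G (S.inv p) u) = 0 := by
      have h11 := leftDeriv_clm_comp S.isCosetFunction.contMDiff S.proj (paramOne I G (S.inv p))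
      simp only [S.proj_map] at h11
      rw [← h6]
      exact congrArg (fun L : E →L[ℝ] E => L (leftTransport I G (S.inv p) u)) h11
    exact hψ.leftDeriv_eq_zero _ (h4 _ h10)
  choose! D hD hDz using key
  have hmem : ∀ t ∈ Icc (0 : ℝ) 1,
      AffineMap.lineMap (S.proj q) q t ∈ Metric.ball (0 : E) r := fun t ht =>
    (convex_ball (0 : E) r).lineMap_mem hπq hq ht
  have hder : ∀ t ∈ Icc (0 : ℝ) 1, HasDerivWithinAt
      (fun t : ℝ => ψ (paramOne I G (S.inv (AffineMap.lineMap (S.proj q) q t)))) 0 (Icc 0 1) t := by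
    intro t ht
    have h1 := (hD _ (hmem t ht)).comp_hasDerivAt t
      (AffineMap.hasDerivAt_lineMap (a := S.proj q) (b := q) (x := t))
    rw [hDz _ (hmem t ht) _ (by rw [map_sub, S.proj_proj, sub_self])] at h1
    exact h1.hasDerivWithinAt
  have := (convex_Icc (0 : ℝ) 1).norm_image_sub_le_of_norm_hasDerivWithin_le hder
    (C := 0) (by simp) (left_mem_Icc.mpr zero_le_one) (right_mem_Icc.mpr zero_le_one)
  simp only [AffineMap.lineMap_apply_one, AffineMap.lineMap_apply_zero, zero_mul,
    norm_le_zero_iff, sub_eq_zero] at this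
  exact this

theorem eventually_inv_mul_mem (hH : IsCompact (H : Set G)) : ∀ᶠ q in 𝓝 (0 : E),
    (paramOne I G (S.inv (S.proj q)))⁻¹ * paramOne I G (S.inv q) ∈ H := by
  filter_upwards [S.eventually_eq_inv_proj] with q hq
  exact inv_mul_mem_of_forall_isCosetFunction (I := I) hH fun ψ hψ => (hq ψ hψ).symm

/-- In straightened coordinates, the kernel of the projection parametrizes elements of `H`. -/
theorem eventually_mem_of_proj_eq_zero (hH : IsCompact (H : Set G)) :
    ∀ᶠ z in 𝓝 (0 : E), S.proj z = 0 → paramOne I G (S.inv z) ∈ H := by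
  filter_upwards [S.eventually_inv_mul_mem hH] with z hz h0
  simpa [h0, S.inv_zero] using hz

omit [FiniteDimensional ℝ E] [I.Boundaryless] in
/-- All elements of `H` near `1` are obtained from the kernel of the projection. -/
theorem eventually_eq_of_mem : ∀ᶠ g in 𝓝 (1 : G), g ∈ H →
    g = paramOne I G (S.inv (coordOne I g - S.proj (coordOne I g))) := by
  filter_upwards [eventually_paramOne_coordOne (G := G) I,
    (tendsto_coordOne I G).eventually S.eventually_inv_left] with g h1 h2 hg
  rw [h1, S.isCosetFunction.eq_one hg, S.map_one, zero_add] at h2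
  rw [h2, h1]

/-- The range of the projection parametrizes a local transversal to `H`. -/
theorem eventually_exists_eq_paramOne_mul (hH : IsCompact (H : Set G)) {r : ℝ} (hr : 0 < r) :
    ∀ᶠ g in 𝓝 (1 : G), ∃ w, S.proj w = w ∧ ‖w‖ < r ∧ ∃ h ∈ H, g = paramOne I G w * h := by
  have hF : Tendsto (fun g : G => S.map (paramOne I G (coordOne I g)) +
      (coordOne I g - S.proj (coordOne I g))) (𝓝 1) (𝓝 0) := by
    have h1 : Tendsto (fun g : G => S.map (paramOne I G (coordOne I g))) (𝓝 1) (𝓝 0) := by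
      have := (S.isCosetFunction.contMDiff.continuous.tendsto 1)
      rw [S.map_one] at this
      exact this.comp ((tendsto_paramOne I G).comp (tendsto_coordOne I G))
    have h2 := tendsto_coordOne I G
    simpa using h1.add (h2.sub (S.tendsto_proj.comp h2))
  filter_upwards [eventually_paramOne_coordOne (G := G) I,
    (tendsto_coordOne I G).eventually S.eventually_inv_left,
    hF.eventually (S.eventually_inv_mul_mem hH),
    hF.eventually (S.tendsto_proj.eventually S.eventually_sub_proj_inv),
    hF.eventually (S.tendsto_proj.eventually
      (S.tendsto_inv.eventually (Metric.ball_mem_nhds 0 hr)))] with g h1 h2 h3 h4 h5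
  rw [h2] at h3
  simp only [h1] at h3 h4 h5
  rw [S.proj_proj, sub_self, sub_eq_zero] at h4
  refine ⟨_, h4.symm, by simpa using h5, _, h3, ?_⟩
  rw [mul_inv_cancel_left]

end StraightCoords

end StraightCoords

/-! ### Subgroups close to a compact subgroup -/

section Neighboring

open scoped Pointwise

variable {G : Type*} [Group G] [TopologicalSpace G] [IsTopologicalGroup G] {H : Subgroup G}

theorem Subgroup.exists_open_mul_subset (hH : IsCompact (H : Set G)) {Q : Set G}
    (hQ : Q ∈ 𝓝ˢ (H : Set G)) :
    ∃ O : Set G, IsOpen O ∧ (H : Set G) ⊆ O ∧ O * O ⊆ Q ∧ O⁻¹ * O ⊆ Q := by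
  have h1 : Tendsto (fun q : G × G => q.1 * q.2) (𝓝ˢ (H : Set G) ×ˢ 𝓝ˢ (H : Set G))
      (𝓝ˢ (H : Set G)) := by
    rw [← hH.nhdsSet_prod_eq hH]
    exact continuous_mul.tendsto_nhdsSet fun q hq => H.mul_mem hq.1 hq.2
  have h2 : Tendsto (fun q : G × G => q.1⁻¹ * q.2) (𝓝ˢ (H : Set G) ×ˢ 𝓝ˢ (H : Set G))
      (𝓝ˢ (H : Set G)) := by
    rw [← hH.nhdsSet_prod_eq hH]
    exact (continuous_fst.inv.mul continuous_snd).tendsto_nhdsSet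
      fun q hq => H.mul_mem (H.inv_mem hq.1) hq.2
  obtain ⟨A, hA, B, hB, hAB⟩ := mem_prod_iff.mp (inter_mem (h1 hQ) (h2 hQ))
  obtain ⟨O, hO, hHO, hOAB⟩ := mem_nhdsSet_iff_exists.mp (inter_mem hA hB)
  refine ⟨O, hO, hHO, ?_, ?_⟩
  · rintro _ ⟨a, ha, b, hb, rfl⟩
    exact (hAB (mk_mem_prod (hOAB ha).1 (hOAB hb).2)).1
  · rintro _ ⟨a, ha, b, hb, rfl⟩
    simpa using (hAB (mk_mem_prod (hOAB ha).1 (hOAB hb).2)).2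

theorem Subgroup.mul_mem_nhdsSet {B : Set G} (hB : B * (H : Set G) ∈ 𝓝 1) :
    B * (H : Set G) ∈ 𝓝ˢ (H : Set G) := by
  rw [mem_nhdsSet_iff_forall]
  intro h hh
  have h1 : Tendsto (fun g : G => g * h⁻¹) (𝓝 h) (𝓝 1) := by
    have := (continuous_mul_const h⁻¹).tendsto h
    rwa [mul_inv_cancel] at this
  filter_upwards [h1 hB] with g hg
  obtain ⟨b, hb, k, hk, hbk⟩ := hg
  exact ⟨b, hb, k * h, H.mul_mem hk hh, by simpa [mul_assoc, eq_mul_inv_iff_mul_eq] using hbk⟩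

theorem Subgroup.mul_self_mem_nhdsSet {B : Set G} (hB : B ∈ 𝓝 1) :
    B * (H : Set G) ∈ 𝓝ˢ (H : Set G) :=
  Subgroup.mul_mem_nhdsSet (mem_of_superset hB fun b hb => ⟨b, hb, 1, H.one_mem, mul_one b⟩)

/-- A compact subgroup `K` close to `H` is conjugate into `H` by an element close to `1`, provided
there is a continuous function `p` on `G/H` vanishing at the base point which is strictly
midpoint-convex near `H` in directions transverse to `H`. The function `g ↦ max_{k ∈ K} p (k * g)`
is then again strictly midpoint-convex and is `K`-invariant, so its minimum over a compact
neighborhood of `H` is attained on a single coset, which is fixed by `K`. -/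
theorem Subgroup.exists_nhdsSet_forall_conj_mem [T2Space G] [LocallyCompactSpace G]
    (hH : IsCompact (H : Set G)) {p : G → ℝ} (hp : Continuous p) (hp0 : ∀ g, 0 ≤ p g)
    (hpH : ∀ g, ∀ h ∈ H, p (g * h) = p g) (hp1 : p 1 = 0)
    (hconv : ∀ N ∈ 𝓝 (1 : G), ∃ T : Set G, T * (H : Set G) ∈ 𝓝 1 ∧ ∃ Z ∈ 𝓝ˢ (H : Set G),
      ∀ t ∈ T, t ∉ H → ∃ m ∈ N, ∀ x ∈ Z, p (x * m) < max (p x) (p (x * t)))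
    {N : Set G} (hN : N ∈ 𝓝 1) :
    ∃ U ∈ 𝓝ˢ (H : Set G), ∀ K : Subgroup G, IsCompact (K : Set G) → (K : Set G) ⊆ U →
      ∃ u ∈ N, ∀ k ∈ K, u⁻¹ * k * u ∈ H := by
  -- Near the identity, `p` vanishes only on `H`.
  have hzero : ∀ᶠ g in 𝓝 (1 : G), p g = 0 → g ∈ H := by
    obtain ⟨T, hT, Z, hZ, hTZ⟩ := hconv univ univ_mem
    filter_upwards [hT] with g hg hpg
    obtain ⟨t, ht, h, hh, rfl⟩ := hg
    refine H.mul_mem ?_ hh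
    by_contra htH
    obtain ⟨m, -, hm⟩ := hTZ t ht htH
    have h1 := hm 1 (mem_of_mem_nhds (mem_nhdsSet_iff_forall.mp hZ 1 H.one_mem))
    rw [hpH t h hh] at hpg
    rw [one_mul, one_mul, hp1, hpg, max_self] at h1
    exact (hp0 m).not_gt h1
  obtain ⟨B, hB1, hB, hBc⟩ := LocallyCompactSpace.local_compact_nhds _ _ hzero
  set Q : Set G := B * (H : Set G) with hQ
  have hQc : IsCompact Q := hBc.mul hH
  have hQn : Q ∈ 𝓝ˢ (H : Set G) := Subgroup.mul_self_mem_nhdsSet hB1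
  have hQz : ∀ g ∈ Q, p g = 0 → g ∈ H := by
    rintro _ ⟨b, hb, h, hh, rfl⟩ h0
    rw [hpH b h hh] at h0
    exact H.mul_mem (hB hb h0) hh
  obtain ⟨O₁, hO₁, hHO₁, hO₁Q, -⟩ := Subgroup.exists_open_mul_subset hH hQn
  obtain ⟨T, hT, Z, hZ, hTZ⟩ := hconv O₁ (hO₁.mem_nhds (hHO₁ H.one_mem))
  obtain ⟨O₂, hO₂, hHO₂, hO₂Q, -⟩ := Subgroup.exists_open_mul_subset hH (inter_mem hQn hZ)
  obtain ⟨O₃, hO₃, hHO₃, -, hO₃T⟩ :=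
    Subgroup.exists_open_mul_subset hH (Subgroup.mul_mem_nhdsSet hT)
  obtain ⟨O₄, hO₄, hHO₄, hO₄N⟩ :=
    mem_nhdsSet_iff_exists.mp (Subgroup.mul_self_mem_nhdsSet (H := H) hN)
  set O := O₁ ∩ O₂ ∩ O₃ ∩ O₄ with hO
  have hOo : IsOpen O := ((hO₁.inter hO₂).inter hO₃).inter hO₄
  have hHO : (H : Set G) ⊆ O := fun h hh => ⟨⟨⟨hHO₁ hh, hHO₂ hh⟩, hHO₃ hh⟩, hHO₄ hh⟩
  obtain ⟨ε, hε, hεO⟩ : ∃ ε > 0, ∀ g ∈ Q, p g < ε → g ∈ O := by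
    rcases (Q \ O).eq_empty_or_nonempty with he | hne
    · exact ⟨1, one_pos, fun g hg _ => by_contra fun h => he.le ⟨hg, h⟩⟩
    · obtain ⟨g₁, hg₁, hmin⟩ := (hQc.diff hOo).exists_isMinOn hne hp.continuousOn
      refine ⟨p g₁, (hp0 g₁).lt_of_ne' fun h => hg₁.2 (hHO (hQz g₁ hg₁.1 h)), fun g hg hlt => ?_⟩
      by_contra h
      exact (isMinOn_iff.mp hmin g ⟨hg, h⟩).not_gt hlt
  have hpε : {x | p x < ε} ∈ 𝓝ˢ (H : Set G) :=
    (isOpen_lt hp continuous_const).mem_nhdsSet.mpr fun h hh => by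
      have := hpH 1 h hh
      rw [one_mul, hp1] at this
      exact this.trans_lt hε
  refine ⟨O ∩ {x | p x < ε}, inter_mem (hOo.mem_nhdsSet.mpr hHO) hpε, fun K hK hKU => ?_⟩
  -- The maximum of the translates of `p` by `K`.
  let m : G → ℝ := fun g => sSup ((fun k => p (k * g)) '' (K : Set G))
  have hmc : Continuous m :=
    hK.continuous_sSup (f := fun g k => p (k * g))
      (hp.comp (continuous_snd.mul continuous_fst))
  have hKne : (K : Set G).Nonempty := ⟨1, K.one_mem⟩
  have hmax : ∀ g, ∃ k ∈ K, m g = p (k * g) ∧ ∀ k' ∈ K, p (k' * g) ≤ m g := by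
    intro g
    obtain ⟨k, hk, h1, h2⟩ := hK.exists_sSup_image_eq_and_ge hKne
      (hp.comp (continuous_mul_const g)).continuousOn
    exact ⟨k, hk, h1, fun k' hk' => (h2 k' hk').trans_eq h1.symm⟩
  have hmle : ∀ g, ∀ k ∈ K, p (k * g) ≤ m g := fun g => (hmax g).choose_spec.2.2
  have hmK : ∀ g, ∀ k ∈ K, m (k * g) ≤ m g := by
    intro g k hk
    obtain ⟨k', hk', h1, -⟩ := hmax (k * g)
    rw [h1, ← mul_assoc]
    exact hmle g _ (K.mul_mem hk' hk)
  have hmH : ∀ g, ∀ h ∈ H, m (g * h) = m g := by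
    intro g h hh
    simp only [m, ← mul_assoc, hpH _ h hh]
  have hQ1 : (1 : G) ∈ Q := ⟨1, mem_of_mem_nhds hB1, 1, H.one_mem, mul_one 1⟩
  obtain ⟨g₀, hg₀Q, hg₀⟩ := hQc.exists_isMinOn ⟨1, hQ1⟩ hmc.continuousOn
  rw [isMinOn_iff] at hg₀
  have hm1 : m 1 < ε := by
    obtain ⟨k, hk, h1, -⟩ := hmax 1
    rw [h1, mul_one]
    exact (hKU hk).2
  have hsmall : ∀ g ∈ Q, m g ≤ m g₀ → g ∈ O := by
    intro g hg hle
    refine hεO g hg ?_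
    have h1 := hmle g 1 K.one_mem
    rw [one_mul] at h1
    exact h1.trans_lt (hle.trans_lt ((hg₀ 1 hQ1).trans_lt hm1))
  have hg₀O : g₀ ∈ O := hsmall g₀ hg₀Q le_rfl
  have hKg : ∀ k ∈ K, k * g₀ ∈ Q ∩ Z := fun k hk =>
    hO₂Q ⟨k, (hKU hk).1.1.1.2, g₀, hg₀O.1.1.2, rfl⟩
  have hfix : ∀ k ∈ K, g₀⁻¹ * k * g₀ ∈ H := by
    intro k hk
    have hkO : k * g₀ ∈ O := hsmall _ (hKg k hk).1 (hmK g₀ k hk)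
    obtain ⟨t, ht, h, hh, hth⟩ := hO₃T ⟨g₀⁻¹, inv_mem_inv.mpr hg₀O.1.2, k * g₀, hkO.1.2, rfl⟩
    simp only at hth
    rw [mul_assoc, ← hth]
    refine H.mul_mem ?_ hh
    by_contra htH
    obtain ⟨μ, hμ, hlt⟩ := hTZ t ht htH
    have hle := hg₀ (g₀ * μ) (hO₁Q ⟨g₀, hg₀O.1.1.1, μ, hμ, rfl⟩)
    obtain ⟨k', hk', h1, -⟩ := hmax (g₀ * μ)
    have h2 := hlt (k' * g₀) (hKg k' hk').2
    rw [mul_assoc, ← h1, mul_assoc] at h2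
    have h3 : m (g₀ * t) ≤ m g₀ := by
      rw [← hmH _ h hh, mul_assoc, hth, mul_inv_cancel_left]
      exact hmK g₀ k hk
    exact hle.not_gt (h2.trans_le (max_le (hmle g₀ k' hk') ((hmle _ k' hk').trans h3)))
  obtain ⟨u, hu, h, hh, huh⟩ := hO₄N hg₀O.2
  refine ⟨u, hu, fun k hk => ?_⟩
  have h1 := H.mul_mem (H.mul_mem hh (hfix k hk)) (H.inv_mem hh)
  rw [← huh] at h1
  simpa [mul_assoc] using h1

end Neighboring

/-! ### Midpoint convexity of coset functions in transverse directions -/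

section Convexity

/-- If `y` differs from the midpoint of `a` and `b` by much less than `‖b - a‖`, then `y` is closer
to `0` than one of `a` and `b`: the defect `‖b - a‖² / 4` in the parallelogram law absorbs the
difference. -/
theorem norm_lt_max_of_near_midpoint {V : Type*} [NormedAddCommGroup V] [InnerProductSpace ℝ V]
    {a b y : V} {δ : ℝ} (hd : 0 < ‖b - a‖)
    (hδ : ‖y - (2⁻¹ : ℝ) • (a + b)‖ ≤ δ) (hδ1 : δ ≤ ‖b - a‖ / 16)
    (hδ2 : ‖a‖ * δ ≤ ‖b - a‖ ^ 2 / 32) : ‖y‖ < max ‖a‖ ‖b‖ := by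
  set d := ‖b - a‖ with hdef
  set m := (2⁻¹ : ℝ) • (a + b) with hm
  have hδ0 : 0 ≤ δ := (norm_nonneg _).trans hδ
  have h1 : ‖y‖ ≤ ‖m‖ + δ := by
    have := norm_add_le m (y - m)
    rw [add_sub_cancel] at this
    linarith
  have h2 : ‖m‖ ≤ ‖a‖ + d / 2 := by
    have h3 : m = a + (2⁻¹ : ℝ) • (b - a) := by rw [hm]; module
    rw [h3]
    refine (norm_add_le _ _).trans ?_
    rw [norm_smul, ← hdef]
    norm_num
    linarith
  have h4 : ‖m‖ ^ 2 = (‖a‖ ^ 2 + ‖b‖ ^ 2) / 2 - d ^ 2 / 4 := by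
    have h5 := parallelogram_law_with_norm ℝ a b
    have h6 : ‖m‖ = ‖a + b‖ / 2 := by rw [hm, norm_smul]; norm_num; ring
    rw [h6, hdef, norm_sub_rev b a]
    nlinarith
  have h7 : ‖y‖ ^ 2 < (‖a‖ ^ 2 + ‖b‖ ^ 2) / 2 := by
    have h8 : ‖y‖ ^ 2 ≤ (‖m‖ + δ) ^ 2 := pow_le_pow_left₀ (norm_nonneg _) h1 2
    have h9 : ‖m‖ * δ ≤ (‖a‖ + d / 2) * δ := mul_le_mul_of_nonneg_right h2 hδ0
    have h10 : δ ^ 2 ≤ (d / 16) ^ 2 := pow_le_pow_left₀ hδ0 hδ1 2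
    have h11 : d * δ ≤ d * (d / 16) := mul_le_mul_of_nonneg_left hδ1 hd.le
    nlinarith [pow_pos hd 2]
  refine lt_of_pow_lt_pow_left₀ 2 (le_max_of_le_left (norm_nonneg a)) ?_
  have h12 : ‖a‖ ^ 2 ≤ max ‖a‖ ‖b‖ ^ 2 := pow_le_pow_left₀ (norm_nonneg _) (le_max_left _ _) 2
  have h13 : ‖b‖ ^ 2 ≤ max ‖a‖ ‖b‖ ^ 2 := pow_le_pow_left₀ (norm_nonneg _) (le_max_right _ _) 2
  linarith

variable {E : Type*} [NormedAddCommGroup E] [NormedSpace ℝ E] [FiniteDimensional ℝ E]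
  {M : Type*} [TopologicalSpace M] {I : ModelWithCorners ℝ E M} [I.Boundaryless]
  {G : Type*} [Group G] [TopologicalSpace G] [ChartedSpace M G] [LieGroup I ∞ G]
  {H : Subgroup G}

/-- Finitely many left translates of the coset function `map` give a coset function whose
differentials are bounded below in transverse directions along all of `H`. -/
theorem StraightCoords.exists_isCosetFunction_le_norm_leftDeriv (S : StraightCoords I H)
    (hH : IsCompact (H : Set G)) :
    ∃ (n : ℕ) (Ψ : G → EuclideanSpace ℝ (Fin n)), IsCosetFunction I H Ψ ∧ Ψ 1 = 0 ∧
      ∃ c > 0, ∀ᶠ x in 𝓝ˢ (H : Set G), ∀ w, S.proj w = w → c * ‖w‖ ≤ ‖leftDeriv I Ψ x w‖ := by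
  have := topologicalGroup_of_lieGroup (G := G) I ∞
  obtain ⟨N, hN, hNo, hN1⟩ := eventually_nhds_iff.mp S.eventually_le_norm_leftDeriv
  obtain ⟨t, htH, ht⟩ := hH.elim_nhds_subcover (fun h => (fun x => h⁻¹ * x) ⁻¹' N) fun h _ =>
    (hNo.preimage (continuous_const_mul h⁻¹)).mem_nhds (by simpa using hN1)
  have hΨ : IsCosetFunction I H fun g (h : t) => S.map ((h : G)⁻¹ * g) :=
    IsCosetFunction.pi fun h => S.isCosetFunction.comp_mul_left (h : G)⁻¹
  let L : (t → E) ≃L[ℝ] EuclideanSpace ℝ (Fin (Module.finrank ℝ (t → E))) := toEuclidean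
  obtain ⟨K, hK0, hK⟩ : ∃ K > 0, ∀ y, ‖y‖ ≤ K * ‖L y‖ := by
    refine ⟨‖L.symm.toContinuousLinearMap‖ + 1, by positivity, fun y => ?_⟩
    have h1 := L.symm.toContinuousLinearMap.le_opNorm (L y)
    rw [ContinuousLinearEquiv.coe_coe, L.symm_apply_apply] at h1
    nlinarith [norm_nonneg (L y)]
  refine ⟨_, _, hΨ.clm_comp L.toContinuousLinearMap, ?_, (2 * K)⁻¹, by positivity, ?_⟩
  · have h0 : (fun h : t => S.map ((h : G)⁻¹ * 1)) = 0 := by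
      funext h
      rw [mul_one, S.isCosetFunction.eq_one (H.inv_mem (htH h h.2)), S.map_one]
      rfl
    rw [h0, map_zero]
  · have hopen : IsOpen (⋃ h ∈ t, (fun x => h⁻¹ * x) ⁻¹' N) :=
      isOpen_biUnion fun h _ => hNo.preimage (continuous_const_mul h⁻¹)
    filter_upwards [hopen.mem_nhdsSet.mpr ht] with x hx w hw
    obtain ⟨h, hht, hxN⟩ := mem_iUnion₂.mp hx
    rw [leftDeriv_clm_comp (ψ := fun g (h : t) => S.map ((h : G)⁻¹ * g)) hΨ.contMDiff]
    set y := leftDeriv I (fun g (h : t) => S.map ((h : G)⁻¹ * g)) x w with hy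
    have h1 : leftDeriv I S.map (h⁻¹ * x) w = y ⟨h, hht⟩ := by
      have h2 := leftDeriv_clm_comp (ψ := fun g (h : t) => S.map ((h : G)⁻¹ * g)) hΨ.contMDiff
        (ContinuousLinearMap.proj (R := ℝ) (φ := fun _ : t => E) ⟨h, hht⟩) x
      have h3 := congrArg (fun T : E →L[ℝ] E => T w) h2
      rw [← leftDeriv_comp_mul_left S.map]
      have h4 : leftDeriv I (fun g => S.map (h⁻¹ * x * g)) 1
          = leftDeriv I (fun g => S.map (h⁻¹ * g)) x := by
        simp [leftDeriv, mul_assoc]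
      rw [h4]
      exact h3
    have h5 := (hN _ hxN w hw).trans ((congrArg norm h1).le.trans (norm_le_pi_norm y _))
    have h6 := hK y
    change (2 * K)⁻¹ * ‖w‖ ≤ ‖L y‖
    rw [inv_mul_le_iff₀ (by positivity)]
    linarith

omit [FiniteDimensional ℝ E] in
/-- The Taylor estimate, uniformly near a compact set. -/
theorem exists_taylor_bound_of_isCompact {F : Type*} [NormedAddCommGroup F] [NormedSpace ℝ F]
    {ψ : G → F} (hψ : ContMDiff I 𝓘(ℝ, F) 2 ψ) {s : Set G} (hs : IsCompact s) :
    ∃ C : ℝ, ∃ r > 0, ∀ᶠ x in 𝓝ˢ s, ∀ w : E, ‖w‖ < r →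
      ‖ψ (x * paramOne I G w) - ψ x - leftDeriv I ψ x w‖ ≤ C * ‖w‖ ^ 2 := by
  refine hs.induction_on ⟨0, 1, one_pos, by simp⟩ ?_ ?_ ?_
  · rintro s t hst ⟨C, r, hr, h⟩
    exact ⟨C, r, hr, h.filter_mono (nhdsSet_mono hst)⟩
  · rintro s t ⟨C, r, hr, h⟩ ⟨C', r', hr', h'⟩
    refine ⟨max C C', min r r', lt_min hr hr', ?_⟩
    rw [nhdsSet_union, eventually_sup]
    constructor
    · filter_upwards [h] with x hx w hw
      exact (hx w (hw.trans_le (min_le_left _ _))).trans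
        (mul_le_mul_of_nonneg_right (le_max_left _ _) (by positivity))
    · filter_upwards [h'] with x hx w hw
      exact (hx w (hw.trans_le (min_le_right _ _))).trans
        (mul_le_mul_of_nonneg_right (le_max_right _ _) (by positivity))
  · intro x _
    obtain ⟨C, r, hr, h⟩ := exists_taylor_bound hψ x
    obtain ⟨O, hO, hOo, hxO⟩ := eventually_nhds_iff.mp h
    refine ⟨O, mem_nhdsWithin_of_mem_nhds (hOo.mem_nhds hxO), C, r, hr, ?_⟩
    rw [hOo.nhdsSet_eq]
    exact eventually_principal.mpr hO

/-- There is a coset function vanishing on `H` whose norm is strictly midpoint-convex near `H` in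
transverse directions: the error in the midpoint rule is of second order in `w`, whereas
`‖Ψ (x * paramOne w) - Ψ x‖` is bounded below by a multiple of `‖w‖`. -/
theorem StraightCoords.exists_midpoint_lt (S : StraightCoords I H) (hH : IsCompact (H : Set G)) :
    ∃ (n : ℕ) (Ψ : G → EuclideanSpace ℝ (Fin n)), IsCosetFunction I H Ψ ∧ Ψ 1 = 0 ∧
      ∃ r > 0, ∀ᶠ x in 𝓝ˢ (H : Set G), ∀ w, S.proj w = w → w ≠ 0 → ‖w‖ < r →
        ‖Ψ (x * paramOne I G ((2⁻¹ : ℝ) • w))‖ < max ‖Ψ x‖ ‖Ψ (x * paramOne I G w)‖ := by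
  obtain ⟨n, Ψ, hΨ, hΨ1, c, hc, hlow⟩ := S.exists_isCosetFunction_le_norm_leftDeriv hH
  obtain ⟨C₀, r, hr, htay⟩ := exists_taylor_bound_of_isCompact hΨ.contMDiff hH
  obtain ⟨C, hC0, hCC⟩ : ∃ C > 0, C₀ ≤ C := ⟨max C₀ 1, by positivity, le_max_left _ _⟩
  refine ⟨n, Ψ, hΨ, hΨ1, min r (c / (32 * C)), by positivity, ?_⟩
  have hsmall : ∀ᶠ x in 𝓝ˢ (H : Set G), ‖Ψ x‖ < c ^ 2 / (128 * C) :=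
    (isOpen_lt hΨ.contMDiff.continuous.norm continuous_const).mem_nhdsSet.mpr fun h hh => by
      change ‖Ψ h‖ < _
      rw [hΨ.eq_one hh, hΨ1, norm_zero]
      positivity
  filter_upwards [hlow, htay, hsmall] with x h1 h2 h3 w hw hw0 hwr
  have hw0' : 0 < ‖w‖ := norm_pos_iff.mpr hw0
  have hwr1 := hwr.trans_le (min_le_left _ _)
  have hwr2 : ‖w‖ * (32 * C) < c :=
    (lt_div_iff₀ (by positivity)).mp (hwr.trans_le (min_le_right _ _))
  set A := leftDeriv I Ψ x
  have hhalf : ‖(2⁻¹ : ℝ) • w‖ = ‖w‖ / 2 := by rw [norm_smul]; norm_num; ring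
  have e1 : ‖Ψ (x * paramOne I G w) - Ψ x - A w‖ ≤ C * ‖w‖ ^ 2 :=
    (h2 w hwr1).trans (mul_le_mul_of_nonneg_right hCC (by positivity))
  have e2 : ‖Ψ (x * paramOne I G ((2⁻¹ : ℝ) • w)) - Ψ x - A ((2⁻¹ : ℝ) • w)‖
      ≤ C * ‖w‖ ^ 2 / 4 := by
    refine (h2 _ (by rw [hhalf]; linarith)).trans ?_
    rw [hhalf]
    nlinarith [sq_nonneg ‖w‖]
  set a := Ψ x
  set b := Ψ (x * paramOne I G w)
  set y := Ψ (x * paramOne I G ((2⁻¹ : ℝ) • w))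
  have hba : c / 2 * ‖w‖ ≤ ‖b - a‖ := by
    have h4 : ‖A w‖ ≤ ‖b - a‖ + ‖b - a - A w‖ := by
      have := norm_sub_le (b - a) (b - a - A w)
      rwa [sub_sub_cancel] at this
    have h5 := h1 w hw
    nlinarith
  have hba0 : 0 < ‖b - a‖ := lt_of_lt_of_le (by positivity) hba
  refine norm_lt_max_of_near_midpoint (δ := C * ‖w‖ ^ 2) hba0 ?_ ?_ ?_
  · have h6 : y - (2⁻¹ : ℝ) • (a + b)
        = (y - a - A ((2⁻¹ : ℝ) • w)) - (2⁻¹ : ℝ) • (b - a - A w) := by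
      rw [map_smul]; module
    have h7 : ‖(2⁻¹ : ℝ) • (b - a - A w)‖ ≤ C * ‖w‖ ^ 2 / 2 := by
      rw [norm_smul]; norm_num; linarith
    rw [h6]
    refine (norm_sub_le _ _).trans ?_
    nlinarith [mul_pos hC0 (pow_pos hw0' 2)]
  · nlinarith
  · have h8 : (c / 2 * ‖w‖) ^ 2 ≤ ‖b - a‖ ^ 2 := pow_le_pow_left₀ (by positivity) hba 2
    have h9 : ‖a‖ * (128 * C) < c ^ 2 := (lt_div_iff₀ (by positivity)).mp h3
    nlinarith [mul_lt_mul_of_pos_right h9 (pow_pos hw0' 2)]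

/-- The theorem of Montgomery and Zippin on neighboring subgroups: a compact subgroup `K` of a Lie
group contained in a small neighborhood of a compact subgroup `H` is conjugate to a subgroup of
`H` by an element close to `1`. -/
theorem exists_nhdsSet_forall_conj_mem_of_lieGroup {E : Type*} [NormedAddCommGroup E]
    [NormedSpace ℝ E] [FiniteDimensional ℝ E] {M : Type*} [TopologicalSpace M]
    (I : ModelWithCorners ℝ E M) [I.Boundaryless] {G : Type*} [Group G] [TopologicalSpace G]
    [ChartedSpace M G] [LieGroup I ∞ G] {H : Subgroup G} (hH : IsCompact (H : Set G))
    {N : Set G} (hN : N ∈ 𝓝 1) :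
    ∃ U ∈ 𝓝ˢ (H : Set G), ∀ K : Subgroup G, IsCompact (K : Set G) → (K : Set G) ⊆ U →
      ∃ u ∈ N, ∀ k ∈ K, u⁻¹ * k * u ∈ H := by
  have := topologicalGroup_of_lieGroup (G := G) I ∞
  have := t2Space_of_lieGroup (G := G) I
  have := Manifold.locallyCompact_of_finiteDimensional (M := G) I
  obtain ⟨S⟩ := nonempty_straightCoords I H
  obtain ⟨n, Ψ, hΨ, hΨ1, r, hr, hmid⟩ := S.exists_midpoint_lt hH
  refine Subgroup.exists_nhdsSet_forall_conj_mem hH hΨ.contMDiff.continuous.norm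
    (fun g => norm_nonneg _) (fun g h hh => by rw [hΨ.mul_right g h hh]) (by simp [hΨ1]) ?_ hN
  intro N' hN'
  obtain ⟨r', hr', hball⟩ :=
    Metric.eventually_nhds_iff_ball.mp ((tendsto_paramOne I G).eventually hN')
  refine ⟨paramOne I G '' {w | S.proj w = w ∧ ‖w‖ < min r r'}, ?_, _, hmid, ?_⟩
  · filter_upwards [S.eventually_exists_eq_paramOne_mul hH (lt_min hr hr')] with g hg
    obtain ⟨w, hw, hwr, h, hh, rfl⟩ := hg
    exact ⟨_, ⟨w, ⟨hw, hwr⟩, rfl⟩, h, hh, rfl⟩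
  · rintro _ ⟨w, ⟨hw, hwr⟩, rfl⟩ hwH
    refine ⟨paramOne I G ((2⁻¹ : ℝ) • w), hball _ ?_, fun x hx => hx w hw ?_ ?_⟩
    · have : ‖(2⁻¹ : ℝ) • w‖ = ‖w‖ / 2 := by rw [norm_smul]; norm_num; ring
      rw [mem_ball_zero_iff, this]
      linarith [hwr.trans_le (min_le_right _ _), norm_nonneg w]
    · rintro rfl
      exact hwH (by simp [H.one_mem])
    · exact hwr.trans_le (min_le_left _ _)

end Convexity

/-! ### A compact subgroup is not conjugate to a proper subgroup of itself -/

section CoHopfian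

/-- An injective continuous endomorphism of a compact group with open identity component is
surjective as soon as its range is open: it maps the identity component onto itself, and the index
of the identity component is finite. -/
theorem MonoidHom.surjective_of_isOpen_connectedComponent {K : Type*} [Group K]
    [TopologicalSpace K] [IsTopologicalGroup K] [CompactSpace K] [T2Space K] (f : K →* K)
    (hf : Continuous f) (hinj : Function.Injective f) (hrange : Set.range f ∈ 𝓝 (1 : K))
    (hconn : connectedComponent (1 : K) ∈ 𝓝 1) : Function.Surjective f := by
  set K₀ := Subgroup.connectedComponentOfOne K with hK₀
  have hK₀c : (K₀ : Set K) = connectedComponent 1 := rfl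
  have hK₀o : IsOpen (K₀ : Set K) := K₀.isOpen_of_mem_nhds (g := 1) hconn
  have hmap : K₀.map f = K₀ := by
    apply le_antisymm
    · rintro _ ⟨k, hk, rfl⟩
      have h1 := hf.image_connectedComponent_subset 1
      rw [map_one] at h1
      exact h1 ⟨k, hk, rfl⟩
    · have hemb := hf.isClosedEmbedding hinj
      have h1 : (K₀.map f : Set K) ∈ 𝓝 (1 : K) := by
        have h2 : (K₀ : Set K) ∈ comap f (𝓝 1) := by
          have := hemb.isInducing.nhds_eq_comap 1
          rw [map_one] at this
          rw [← this]
          exact hconn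
        obtain ⟨V, hV, hVK⟩ := h2
        filter_upwards [hV, hrange] with k hkV hk
        obtain ⟨a, rfl⟩ := hk
        exact ⟨a, hVK hkV, rfl⟩
      have h3 : IsOpen (K₀.map f : Set K) := (K₀.map f).isOpen_of_mem_nhds (g := 1) h1
      have h4 : IsClopen (K₀.map f : Set K) := ⟨(K₀.map f).isClosed_of_isOpen h3, h3⟩
      exact h4.connectedComponent_subset (K₀.map f).one_mem
  have hfin : Finite (K ⧸ K₀) := K₀.quotient_finite_of_isOpen hK₀o
  have hidx := K₀.index_map f
  rw [hmap, (f.ker_eq_bot_iff).mpr hinj, sup_bot_eq] at hidx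
  have := K₀.finiteIndex_of_finite_quotient
  have hne : K₀.index ≠ 0 := Subgroup.FiniteIndex.index_ne_zero
  have h1 : f.range.index = 1 := by
    rcases Nat.eq_zero_or_pos f.range.index with h | h
    · rw [h, mul_zero] at hidx; exact absurd hidx hne
    · exact (Nat.eq_of_mul_eq_mul_left (Nat.pos_of_ne_zero hne) (by rw [← hidx, mul_one])).symm
  exact MonoidHom.range_eq_top.mp (Subgroup.index_eq_one.mp h1)

theorem tendsto_conj_one {G : Type*} [Group G] [TopologicalSpace G] [IsTopologicalGroup G] (c : G) :
    Tendsto (fun g : G => c * g * c⁻¹) (𝓝 1) (𝓝 1) := by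
  have : Continuous fun g : G => c * g * c⁻¹ := by fun_prop
  simpa using this.tendsto 1

variable {E : Type*} [NormedAddCommGroup E] [NormedSpace ℝ E]
  {M : Type*} [TopologicalSpace M] (I : ModelWithCorners ℝ E M) [I.Boundaryless]
  {G : Type*} [Group G] [TopologicalSpace G] [ChartedSpace M G] [LieGroup I ∞ G]

/-- Conjugation by `c` in the coordinates `coordOne`. -/
noncomputable def conjCoord (c : G) (v : E) : E := coordOne I (c * paramOne I G v * c⁻¹)

omit [I.Boundaryless] [LieGroup I ∞ G] in
theorem conjCoord_zero (c : G) : conjCoord I c (0 : E) = 0 := by simp [conjCoord]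

omit [I.Boundaryless] in
theorem contMDiff_conj (c : G) : ContMDiff I I ∞ fun g : G => c * g * c⁻¹ :=
  (contMDiff_mul_right (I := I) (n := ∞) (a := c⁻¹)).comp
    (contMDiff_mul_left (I := I) (n := ∞) (a := c))

theorem contDiffAt_conjCoord (c : G) : ContDiffAt ℝ 2 (conjCoord I c) (0 : E) := by
  have h1 : ContMDiffAt 𝓘(ℝ, E) I ∞ (fun v => c * paramOne I G v * c⁻¹) (0 : E) :=
    (contMDiff_conj I c).contMDiffAt.comp (0 : E) (contMDiffAt_paramOne I G)
  have h2 : ContMDiffAt 𝓘(ℝ, E) 𝓘(ℝ, E) ∞ (conjCoord I c) (0 : E) :=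
    ContMDiffAt.comp (I' := I) (0 : E) (g := coordOne I)
      (by simpa using contMDiffAt_coordOne (G := G) I) h1
  exact h2.contDiffAt.of_le ENat.LEInfty.out

theorem eventually_paramOne_conjCoord (c : G) :
    ∀ᶠ v in 𝓝 (0 : E), paramOne I G (conjCoord I c v) = c * paramOne I G v * c⁻¹ :=
  have := topologicalGroup_of_lieGroup (G := G) I ∞
  ((tendsto_conj_one c).comp (tendsto_paramOne I G)).eventually (eventually_paramOne_coordOne I)

theorem injective_fderiv_conjCoord (c : G) :
    Function.Injective (fderiv ℝ (conjCoord I c) (0 : E)) := by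
  have h1 : ∀ᶠ v in 𝓝 (0 : E), conjCoord I c⁻¹ (conjCoord I c v) = v := by
    filter_upwards [eventually_paramOne_conjCoord I c, eventually_coordOne_paramOne I G]
      with v hv hv'
    rw [conjCoord, hv, show c⁻¹ * (c * paramOne I G v * c⁻¹) * c⁻¹⁻¹ = paramOne I G v by group, hv']
  have hd : ∀ c : G, HasFDerivAt (conjCoord I c) (fderiv ℝ (conjCoord I c) (0 : E)) 0 := fun c =>
    ((contDiffAt_conjCoord I c).differentiableAt (by simp)).hasFDerivAt
  have h2 : HasFDerivAt (conjCoord I c⁻¹) (fderiv ℝ (conjCoord I c⁻¹) (0 : E))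
      (conjCoord I c (0 : E)) := by
    rw [conjCoord_zero]
    exact hd c⁻¹
  have h3 := (h2.comp (0 : E) (hd c)).unique ((hasFDerivAt_id (0 : E)).congr_of_eventuallyEq h1)
  exact Function.LeftInverse.injective fun v => congrArg (fun L : E →L[ℝ] E => L v) h3

variable {I} {H : Subgroup G}

theorem fderiv_conjCoord_mem {c : G} (hc : ∀ h ∈ H, c * h * c⁻¹ ∈ H) {v : E}
    (hv : v ∈ infinitesimalStabilizer I H) :
    fderiv ℝ (conjCoord I c) 0 v ∈ infinitesimalStabilizer I H := by
  intro ψ hψ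
  have h1 : HasFDerivAt (conjCoord I c) (fderiv ℝ (conjCoord I c) (0 : E)) 0 :=
    ((contDiffAt_conjCoord I c).differentiableAt (by simp)).hasFDerivAt
  have h2 := hasFDerivAt_leftDeriv hψ.contMDiff (1 : G)
  rw [← conjCoord_zero I c] at h2
  have h3 := h2.comp (0 : E) h1
  have h4 : HasFDerivAt (fun w => ψ (c * (1 * paramOne I G w) * c⁻¹))
      (leftDeriv I (fun g => ψ (c * g * c⁻¹)) 1) 0 :=
    hasFDerivAt_leftDeriv (hψ.comp_conj hc).contMDiff (1 : G)
  have h5 := h3.unique (h4.congr_of_eventuallyEq (by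
    filter_upwards [eventually_paramOne_conjCoord I c] with w hw
    simp [hw]))
  exact (congrArg (fun L : E →L[ℝ] ℝ => L v) h5).trans (hv _ (hψ.comp_conj hc))

variable [FiniteDimensional ℝ E]

/-- If conjugation by `c` maps `H` into itself, then its image is a neighborhood of `1` in `H`:
its differential is an injective, hence bijective, endomorphism of the Lie algebra of `H`. -/
theorem StraightCoords.eventually_inv_conj_mem (S : StraightCoords I H)
    (hH : IsCompact (H : Set G)) {c : G} (hc : ∀ h ∈ H, c * h * c⁻¹ ∈ H) :
    ∀ᶠ g in 𝓝 (1 : G), g ∈ H → c⁻¹ * g * c ∈ H := by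
  have := topologicalGroup_of_lieGroup (G := G) I ∞
  set D := fderiv ℝ (conjCoord I c) (0 : E) with hD
  let σ : E →L[ℝ] E := ContinuousLinearMap.id ℝ E - S.proj
  have hσ : ∀ q, σ q = q - S.proj q := fun q => rfl
  have hσ0 : ∀ q, S.proj (σ q) = 0 := fun q => by rw [hσ, map_sub, S.proj_proj, sub_self]
  -- Conjugation in straightened coordinates, extended by the identity in transverse directions.
  let R : E → E := fun q => σ (conjCoord I c (S.inv (σ q))) + S.proj q
  have hR0 : R 0 = 0 := by simp [R, S.inv_zero, conjCoord_zero]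
  let R' : E →L[ℝ] E := σ ∘L D ∘L σ + S.proj
  have hR : HasStrictFDerivAt R R' 0 := by
    have h1 : HasStrictFDerivAt (conjCoord I c) D 0 :=
      (contDiffAt_conjCoord I c).hasStrictFDerivAt (by simp)
    have h2 := S.hasStrictFDerivAt_inv
    rw [← map_zero σ] at h2
    have h3 := h2.comp (0 : E) σ.hasStrictFDerivAt
    have h4 : HasStrictFDerivAt (conjCoord I c) D (S.inv (σ 0)) := by
      rwa [map_zero, S.inv_zero]
    exact (σ.hasStrictFDerivAt.comp (0 : E) (h4.comp (0 : E) h3)).add S.proj.hasStrictFDerivAt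
  have hinj : Function.Injective R' := by
    rw [injective_iff_map_eq_zero]
    intro q hq
    have hq' : σ (D (σ q)) + S.proj q = 0 := hq
    have h1 : S.proj q = 0 := by
      have := congrArg S.proj hq'
      simpa [hσ0, S.proj_proj] using this
    have h2 : σ q = q := by rw [hσ, h1, sub_zero]
    have h3 : S.proj (D q) = 0 :=
      (S.proj_eq_zero_iff _).mpr (fderiv_conjCoord_mem hc ((S.proj_eq_zero_iff q).mp h1))
    rw [h1, add_zero, h2, hσ, h3, sub_zero] at hq'
    exact injective_fderiv_conjCoord I c (hq'.trans (map_zero _).symm)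
  have hsurj : R'.range = ⊤ :=
    LinearMap.range_eq_top.mpr
      ((LinearMap.injective_iff_surjective (f := (R' : E →ₗ[ℝ] E))).mp hinj)
  have hmap : Filter.map R (𝓝 0) = 𝓝 0 := by
    have := hR.map_nhds_eq_of_surj hsurj
    rwa [hR0] at this
  have hev : ∀ᶠ q in 𝓝 (0 : E), (S.proj q = 0 → paramOne I G (S.inv q) ∈ H) ∧
      (c * paramOne I G (S.inv q) * c⁻¹ ∈ H → c * paramOne I G (S.inv q) * c⁻¹ =
        paramOne I G (S.inv (σ (coordOne I (c * paramOne I G (S.inv q) * c⁻¹))))) :=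
    (S.eventually_mem_of_proj_eq_zero hH).and
      (((tendsto_conj_one c).comp S.tendsto_paramOne_inv).eventually S.eventually_eq_of_mem)
  have himg : ∀ᶠ z in 𝓝 (0 : E), ∃ q, ((S.proj q = 0 → paramOne I G (S.inv q) ∈ H) ∧
      (c * paramOne I G (S.inv q) * c⁻¹ ∈ H → c * paramOne I G (S.inv q) * c⁻¹ =
        paramOne I G (S.inv (σ (coordOne I (c * paramOne I G (S.inv q) * c⁻¹)))))) ∧ R q = z := by
    rw [← hmap]
    exact image_mem_map hev
  have hσt : Tendsto (fun g : G => σ (coordOne I g)) (𝓝 1) (𝓝 0) := by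
    have := σ.continuous.tendsto 0
    rw [map_zero] at this
    exact this.comp (tendsto_coordOne I G)
  filter_upwards [hσt.eventually himg, S.eventually_eq_of_mem] with g hg hgH hgm
  obtain ⟨q, ⟨hq1, hq2⟩, hRq⟩ := hg
  have h1 : S.proj q = 0 := by
    have := congrArg S.proj hRq
    simpa [R, hσ0, S.proj_proj] using this
  have h2 : σ q = q := by rw [hσ, h1, sub_zero]
  have h3 := hq1 h1
  have h4 := hq2 (hc _ h3)
  have h5 : σ (coordOne I (c * paramOne I G (S.inv q) * c⁻¹)) = σ (coordOne I g) := by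
    rw [← hRq]
    simp [R, h1, h2, conjCoord]
  rw [h5] at h4
  have h6 : g = c * paramOne I G (S.inv q) * c⁻¹ := (hgH hgm).trans h4.symm
  rw [h6, show c⁻¹ * (c * paramOne I G (S.inv q) * c⁻¹) * c = paramOne I G (S.inv q) by group]
  exact h3

/-- A compact subgroup is locally connected: near `1` it is parametrized by a ball of its
Lie algebra. -/
theorem StraightCoords.connectedComponent_one_mem_nhds (S : StraightCoords I H)
    (hH : IsCompact (H : Set G)) : connectedComponent (1 : H) ∈ 𝓝 (1 : H) := by
  have hev := (S.eventually_mem_of_proj_eq_zero hH).and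
    ((S.tendsto_inv.eventually (eventually_contMDiffAt_paramOne I G)).and
      (S.contDiffAt_inv.eventually (by simp)))
  obtain ⟨r, hr, hball⟩ := Metric.eventually_nhds_iff_ball.mp hev
  set Z : Set E := Metric.ball 0 r ∩ {z | S.proj z = 0} with hZ
  have hZc : Convex ℝ Z :=
    (convex_ball _ _).inter (LinearMap.ker (S.proj : E →ₗ[ℝ] E)).convex
  have hcont : ContinuousOn (fun z => paramOne I G (S.inv z)) Z := by
    intro z hz
    obtain ⟨-, h1, h2⟩ := hball z hz.1
    exact (h1.continuousAt.comp h2.continuousAt).continuousWithinAt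
  have hsub : (fun z => paramOne I G (S.inv z)) '' Z ⊆ H := by
    rintro _ ⟨z, hz, rfl⟩
    exact (hball z hz.1).1 hz.2
  have hpre : (fun z => paramOne I G (S.inv z)) '' Z ⊆ connectedComponentIn (H : Set G) 1 :=
    (hZc.isPreconnected.image _ hcont).subset_connectedComponentIn
      ⟨0, ⟨Metric.mem_ball_self hr, map_zero _⟩, by simp [S.inv_zero]⟩ hsub
  rw [connectedComponentIn_eq_image H.one_mem] at hpre
  have hσt : Tendsto (fun g : G => coordOne I g - S.proj (coordOne I g)) (𝓝 1) (𝓝 0) := by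
    simpa using (tendsto_coordOne I G).sub (S.tendsto_proj.comp (tendsto_coordOne I G))
  have hnear : ∀ᶠ g in 𝓝 (1 : G), g ∈ H →
      g ∈ Subtype.val '' connectedComponent (⟨1, H.one_mem⟩ : (H : Set G)) := by
    filter_upwards [S.eventually_eq_of_mem, hσt.eventually (Metric.ball_mem_nhds 0 hr)]
      with g hg hgb hgH
    rw [hg hgH]
    exact hpre ⟨_, ⟨hgb, by simp [S.proj_proj]⟩, rfl⟩
  filter_upwards [(continuous_subtype_val.tendsto (1 : H)).eventually hnear] with h hh
  obtain ⟨k, hk, hkh⟩ := hh h.2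
  rwa [Subtype.ext hkh] at hk

/-- A compact subgroup of a Lie group is not conjugate to a proper subgroup of itself. -/
theorem conj_inv_mem_of_forall_conj_mem {E : Type*} [NormedAddCommGroup E]
    [NormedSpace ℝ E] [FiniteDimensional ℝ E] {M : Type*} [TopologicalSpace M]
    (I : ModelWithCorners ℝ E M) [I.Boundaryless] {G : Type*} [Group G] [TopologicalSpace G]
    [ChartedSpace M G] [LieGroup I ∞ G] {H : Subgroup G} (hH : IsCompact (H : Set G)) {c : G}
    (hc : ∀ h ∈ H, c * h * c⁻¹ ∈ H) {h : G} (hh : h ∈ H) : c⁻¹ * h * c ∈ H := by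
  have := topologicalGroup_of_lieGroup (G := G) I ∞
  have := t2Space_of_lieGroup (G := G) I
  have : CompactSpace H := isCompact_iff_compactSpace.mp hH
  obtain ⟨S⟩ := nonempty_straightCoords I H
  let f : H →* H := ((MulAut.conj c).toMonoidHom.comp H.subtype).codRestrict H fun h => hc h h.2
  have hf : ∀ h : H, (f h : G) = c * h * c⁻¹ := fun h => rfl
  have hfc : Continuous f :=
    ((continuous_const.mul continuous_subtype_val).mul continuous_const).subtype_mk _
  have hinj : Function.Injective f := by
    intro a b hab
    have := congrArg Subtype.val hab
    rw [hf, hf] at this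
    exact Subtype.ext (mul_left_cancel (mul_right_cancel this))
  have hrange : range f ∈ 𝓝 (1 : H) := by
    filter_upwards [(continuous_subtype_val.tendsto (1 : H)).eventually
      (S.eventually_inv_conj_mem hH hc)] with k hk
    exact ⟨⟨_, hk k.2⟩, Subtype.ext (by rw [hf]; group)⟩
  obtain ⟨k, hk⟩ := f.surjective_of_isOpen_connectedComponent hfc hinj hrange
    (S.connectedComponent_one_mem_nhds hH) ⟨h, hh⟩
  have h1 := congrArg Subtype.val hk
  rw [hf] at h1
  rw [← show c * (k : G) * c⁻¹ = h from h1, show c⁻¹ * (c * (k : G) * c⁻¹) * c = k by group]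
  exact k.2

end CoHopfian

/-! ### Proper actions with one orbit type -/

section ProperActions

variable {G : Type*} [Group G] [TopologicalSpace G] {X : Type*} [TopologicalSpace X]
  [MulAction G X]

/-- For a proper action, isotropy groups are upper semicontinuous. -/
theorem ProperSMul.eventually_stabilizer_subset [ProperSMul G X] {x : X} {U : Set G}
    (hU : U ∈ 𝓝ˢ (MulAction.stabilizer G x : Set G)) :
    ∀ᶠ y in 𝓝 x, (MulAction.stabilizer G y : Set G) ⊆ U := by
  obtain ⟨O, hO, hxO, hOU⟩ := mem_nhdsSet_iff_exists.mp hU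
  have hcl : IsClosed ((fun q : G × X => (q.1 • q.2, q.2)) '' (Oᶜ ×ˢ univ)) :=
    (ProperSMul.isProperMap_smul_pair (G := G) (X := X)).isClosedMap _
      (hO.isClosed_compl.prod isClosed_univ)
  have hx : (x, x) ∉ (fun q : G × X => (q.1 • q.2, q.2)) '' (Oᶜ ×ˢ univ) := by
    rintro ⟨⟨g, y⟩, ⟨hg, -⟩, hgy⟩
    simp only [Prod.mk.injEq] at hgy
    obtain ⟨h1, rfl⟩ := hgy
    exact hg (hxO h1)
  have hdiag : Tendsto (fun y : X => (y, y)) (𝓝 x) (𝓝 (x, x)) :=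
    (continuous_id.prodMk continuous_id).tendsto x
  filter_upwards [hdiag.eventually (hcl.isOpen_compl.mem_nhds hx)] with y hy g hg
  by_contra hgU
  exact hy ⟨(g, y), ⟨fun h => hgU (hOU h), mem_univ _⟩, Prod.ext hg rfl⟩

end ProperActions

namespace OneOrbitType

section Phi

variable {G : Type*} [Group G] {X : Type*} [MulAction G X] (H : Subgroup G)

@[simp] theorem phi_mk (g : G) (y : MulAction.fixedPoints H X) :
    Phi H X (BalancedProduct.mk _ g y) = g • (y : X) := rfl

theorem phi_smul (g : G)
    (p : BalancedProduct (Subgroup.normalizer (H : Set G)) (MulAction.fixedPoints H X)) :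
    Phi H X (g • p) = g • Phi H X p := by
  obtain ⟨⟨g', y⟩, rfl⟩ := Quotient.exists_rep p
  exact mul_smul g g' (y : X)

theorem continuous_phi [TopologicalSpace G] [TopologicalSpace X] [ContinuousSMul G X] :
    Continuous (Phi H X) :=
  Continuous.quotient_lift (continuous_fst.smul (continuous_subtype_val.comp continuous_snd)) _

variable {H}

theorem HasOneOrbitType.exists_mem_stabilizer_iff (hone : HasOneOrbitType H X) (x : X) :
    ∃ c : G, ∀ g, g ∈ MulAction.stabilizer G x ↔ c⁻¹ * g * c ∈ H := by
  obtain ⟨c, hc⟩ := hone x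
  refine ⟨c, fun g => ?_⟩
  rw [hc, Subgroup.mem_map]
  constructor
  · rintro ⟨h, hh, rfl⟩
    simpa [mul_assoc] using hh
  · exact fun hg => ⟨_, hg, by simp [mul_assoc]⟩

theorem HasOneOrbitType.surjective_phi (hone : HasOneOrbitType H X) :
    Function.Surjective (Phi H X) := by
  intro x
  obtain ⟨c, hc⟩ := hone.exists_mem_stabilizer_iff x
  have hfix : c⁻¹ • x ∈ MulAction.fixedPoints H X := by
    rintro ⟨h, hh⟩
    have h1 : c * h * c⁻¹ ∈ MulAction.stabilizer G x := (hc _).mpr (by simpa [mul_assoc] using hh)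
    have h2 : (c * h * c⁻¹) • x = x := h1
    change h • c⁻¹ • x = c⁻¹ • x
    conv_rhs => rw [← h2]
    simp [smul_smul, mul_assoc]
  exact ⟨BalancedProduct.mk _ c ⟨_, hfix⟩, by simp⟩

/-- If all points of `X^H` have isotropy group exactly `H`, an element of `G` carrying one of them
to another normalizes `H`. -/
theorem injective_phi
    (hstab : ∀ y ∈ MulAction.fixedPoints H X, MulAction.stabilizer G y = H) :
    Function.Injective (Phi H X) := by
  intro p q hpq
  obtain ⟨⟨g, y⟩, rfl⟩ := Quotient.exists_rep p
  obtain ⟨⟨g', y'⟩, rfl⟩ := Quotient.exists_rep q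
  have h1 : g • (y : X) = g' • (y' : X) := hpq
  have h2 : (g'⁻¹ * g) • (y : X) = y' := by rw [mul_smul, h1, inv_smul_smul]
  have hn : g'⁻¹ * g ∈ Subgroup.normalizer (H : Set G) := by
    rw [Subgroup.mem_normalizer_iff]
    intro h
    have h3 : ∀ k, k ∈ H ↔ k • (y : X) = y := fun k => by
      rw [← MulAction.mem_stabilizer_iff, hstab y y.2]
    have h4 : ∀ k, k ∈ H ↔ k • (y' : X) = y' := fun k => by
      rw [← MulAction.mem_stabilizer_iff, hstab y' y'.2]
    rw [h3, h4, ← h2, smul_smul, inv_mul_cancel_right, mul_smul]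
    exact (smul_left_cancel_iff _).symm
  refine Quotient.sound ⟨⟨_, hn⟩, Prod.ext ?_ (Subtype.ext h2.symm)⟩
  simp

end Phi

end OneOrbitType

theorem mainTheorem7
    {E : Type*} [NormedAddCommGroup E] [NormedSpace ℝ E] [FiniteDimensional ℝ E]
    {M : Type*} [TopologicalSpace M] (I : ModelWithCorners ℝ E M) [I.Boundaryless]
    {G : Type*} [Group G] [TopologicalSpace G] [ChartedSpace M G] [LieGroup I ∞ G]
    {X : Type*} [TopologicalSpace X] [MulAction G X] [ProperSMul G X]
    (hX : T35Space X ∨ Nonempty (OneOrbitType.GCWComplex G X))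
    (H : Subgroup G) (hH : IsCompact (H : Set G))
    (hone : OneOrbitType.HasOneOrbitType H X) :
    IsHomeomorph (OneOrbitType.Phi H X) ∧
      ∀ (g : G) (p : OneOrbitType.BalancedProduct (Subgroup.normalizer (H : Set G))
          (MulAction.fixedPoints H X)),
        OneOrbitType.Phi H X (g • p) = g • OneOrbitType.Phi H X p := by
  have := topologicalGroup_of_lieGroup (G := G) I ∞
  -- An isotropy group that `u⁻¹` conjugates into `H` is all of `u * H * u⁻¹`.
  have hconj : ∀ (x : X) (u : G), (∀ g ∈ MulAction.stabilizer G x, u⁻¹ * g * u ∈ H) →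
      ∀ h ∈ H, u * h * u⁻¹ ∈ MulAction.stabilizer G x := by
    intro x u hu h hh
    obtain ⟨c, hc⟩ := hone.exists_mem_stabilizer_iff x
    have h1 : ∀ k ∈ H, (u⁻¹ * c) * k * (u⁻¹ * c)⁻¹ ∈ H := fun k hk => by
      have := hu (c * k * c⁻¹) ((hc _).mpr (by simpa [mul_assoc] using hk))
      simpa [mul_assoc] using this
    have h2 := conj_inv_mem_of_forall_conj_mem I hH h1 hh
    rw [hc]
    simpa [mul_assoc] using h2
  have hstab : ∀ y ∈ MulAction.fixedPoints H X, MulAction.stabilizer G y = H := by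
    intro y hy
    have hle : H ≤ MulAction.stabilizer G y := fun h hh => hy ⟨h, hh⟩
    obtain ⟨c, hc⟩ := hone.exists_mem_stabilizer_iff y
    refine le_antisymm (fun g hg => ?_) hle
    have h1 : ∀ k ∈ H, c⁻¹ * k * c⁻¹⁻¹ ∈ H := fun k hk => by
      simpa using (hc k).mp (hle hk)
    have h2 := conj_inv_mem_of_forall_conj_mem I hH h1 ((hc g).mp hg)
    simpa [mul_assoc] using h2
  have hopen : IsOpenMap (OneOrbitType.Phi H X) := by
    rw [isOpenMap_iff_nhds_le]
    intro p
    obtain ⟨⟨g, y⟩, rfl⟩ := Quotient.exists_rep p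
    intro A hA
    rw [mem_map] at hA
    -- Pull the neighborhood of `[g, y]` back to `G × X^H`, and extend it to `G × X`.
    have hA' : (fun q : G × MulAction.fixedPoints H X => q.1 • (q.2 : X)) ⁻¹' A ∈ 𝓝 (g, y) :=
      (continuous_quotient_mk' (s := OneOrbitType.balancedSetoid
        (Subgroup.normalizer (H : Set G)) (MulAction.fixedPoints H X))).tendsto (g, y) hA
    have hind : Topology.IsInducing
        (Prod.map id Subtype.val : G × MulAction.fixedPoints H X → G × X) :=
      Topology.IsInducing.id.prodMap Topology.IsInducing.subtypeVal
    rw [hind.nhds_eq_comap] at hA'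
    obtain ⟨V, hV, hVA⟩ := hA'
    have hcont : Tendsto (fun q : G × X => (g * q.1, q.1⁻¹ • g⁻¹ • q.2))
        (𝓝 ((1 : G), g • (y : X))) (𝓝 (g, (y : X))) := by
      have h1 : Continuous fun q : G × X => (g * q.1, q.1⁻¹ • g⁻¹ • q.2) := by fun_prop
      simpa using h1.tendsto ((1 : G), g • (y : X))
    obtain ⟨N, hN, W, hW, hNW⟩ := mem_nhds_prod_iff.mp (hcont hV)
    obtain ⟨U, hU, hUK⟩ := exists_nhdsSet_forall_conj_mem_of_lieGroup I hH hN
    have hU' : U ∈ 𝓝ˢ (MulAction.stabilizer G (y : X) : Set G) := by rwa [hstab y y.2]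
    have hback : Tendsto (fun x : X => g⁻¹ • x) (𝓝 (g • (y : X))) (𝓝 (y : X)) := by
      simpa using (continuous_const_smul g⁻¹).tendsto (g • (y : X))
    change A ∈ 𝓝 (g • (y : X))
    filter_upwards [hW, hback.eventually (ProperSMul.eventually_stabilizer_subset hU')]
      with x hxW hxU
    have hcpt : IsCompact (MulAction.stabilizer G (g⁻¹ • x) : Set G) := by
      obtain ⟨c, hc⟩ := hone (g⁻¹ • x)
      rw [hc]
      have hc' : Continuous fun g : G => c * g * c⁻¹ := by fun_prop
      exact hH.image hc'
    obtain ⟨u, huN, hu⟩ := hUK _ hcpt hxU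
    have hfix : u⁻¹ • g⁻¹ • x ∈ MulAction.fixedPoints H X := by
      rintro ⟨h, hh⟩
      have h1 : (u * h * u⁻¹) • g⁻¹ • x = g⁻¹ • x := hconj _ u hu h hh
      change h • u⁻¹ • g⁻¹ • x = u⁻¹ • g⁻¹ • x
      conv_rhs => rw [← h1]
      simp [smul_smul, mul_assoc]
    have h2 := @hVA (g * u, ⟨_, hfix⟩) (hNW (mk_mem_prod huN hxW))
    simpa [smul_smul, mul_assoc] using h2
  exact ⟨⟨OneOrbitType.continuous_phi H, hopen, OneOrbitType.injective_phi hstab,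
    hone.surjective_phi⟩, OneOrbitType.phi_smul H⟩
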